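/- Let $d\ge 1$, let $\mu=(\mu_j)_{j\ge1}$ be real numbers with $0<\mu_1\le\mu_2\le\cdots$, and let $\tilde\mu:[1,\infty)\to(0,\infty)$ be increasing, continuous and piecewise $\mathcal C^1$ with $\tilde\mu(k)=\mu_k$ for all integers $k\ge1$. Put $$\gamma_{\tilde\mu}(n):=\sup_{1\le s\le n}\frac{s\,\tilde\mu'(s)}{\tilde\mu(s)},\qquad \Gamma_{\tilde\mu}(n):=4e^{4+\gamma_{\tilde\mu}(n)},$$ where $\tilde\mu'$ denotes the left derivative at points $s>1$ where $\tilde\mu$ is not differentiable, and the right derivative at $s=1$. Let $K\subseteq\mathbb R^d$ be compact and convex with non-empty interior, let $\delta_K$ be its diameter, and assume that $\sum_{j\ge1}\frac1{\mu_j}>\delta_K e$. Set $$N:=1+\sup\Big\{n\in\mathbb N:\ \sum_{j=1}^n\frac1{\delta_K\mu_j}<e\Big\},\qquad C_N:=\Gamma_{\tilde\mu}(2(N-1)).$$ Let $f:K\to\mathbb R$ be of class $\mathcal C^{2(N-1)}$ in an open neighbourhood of $K$, with $\|f\|_K:=\sup_K|f|>0$ and $$\sum_{|\alpha|=j}\frac{j!}{\alpha!}\,\|f^{(\alpha)}\|_K\le\|f\|_K\,\mu_1\mu_2\cdots\mu_j,\qquad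 1\le j\le 2(N-1).$$ For measurable $E\subseteq K$ with Lebesgue measure $|E|>0$ write $\|f\|^\sharp_{L^p(E)}:=\big(\frac1{|E|}\int_E|f|^p\,dx\big)^{1/p}$ for $0<p<\infty$ and $\|f\|^\sharp_{L^\infty(E)}:=\operatorname{ess\,sup}_E|f|$. Then for every Lebesgue measurable $E\subseteq K$ with $|E|>0$ and all $0<q<p\le\infty$, $$\|f\|^\sharp_{L^p(K)}\le\Big(\frac{C_N\,d\,|K|}{|E|}\Big)^{2(N-1)(1-\frac qp)}\,(2q(N-1)+1)^{\frac1q-\frac1p}\,\big(\|f\|^\sharp_{L^q(K)}\big)^{\frac qp}\big(\|f\|^\sharp_{L^q(E)}\big)^{1-\frac qp}.$$ In particular, $$\|f\|^\sharp_{L^p(K)}\le(C_N\,d)^{2(N-1)(1-\frac qp)}\,(2q(N-1)+1)^{\frac1q-\frac1p}\,\|f\|^\sharp_{L^q(K)}$$ and $$\|f\|^\sharp_{L^p(K)}\le\Big(\frac{C_N\,d\,|K|}{|E|}\Big)^{2(N-1)}(2q(N-1)+1)^{\frac1q}\,\|f\|^\sharp_{L^q(E)}.$$ Here $q/p=1/p=0$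 if $p=\infty$, and if $N=1$ the right-hand sides of all three inequalities are interpreted as $+\infty$. -/

import Mathlib

open MeasureTheory Set Filter
open scoped ENNReal Topology Nat

/-- An admissible weight with finite entries: a positive increasing sequence `(μ_j)_{j ≥ 1}`
(the value at `0` plays no role). -/
structure IsAdmissibleWeight (μ : ℕ → ℝ) : Prop where
  pos : ∀ j, 1 ≤ j → 0 < μ j
  mono : ∀ j, 1 ≤ j → μ j ≤ μ (j + 1)

/-- `Σ_μ(m, n) = ∑_{j=m}^n 1/μ_j` for finite `n` (zero if `m > n`). -/
noncomputable def weightSum (μ : ℕ → ℝ) (m n : ℕ) : ℝ :=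
  ∑ j ∈ Finset.Icc m n, 1 / μ j

/-- `Σ_μ(m, ∞) = ∑_{j=m}^∞ 1/μ_j`, as an element of `[0, ∞]`. -/
noncomputable def weightSumTop (μ : ℕ → ℝ) (m : ℕ) : ℝ≥0∞ :=
  ∑' j : ℕ, ENNReal.ofReal (1 / μ (m + j))

/-- `j_0(b)`, the smallest natural number that is at least `log (1/b)`. -/
noncomputable def startIndex (b : ℝ) : ℕ := ⌈Real.log b⁻¹⌉₊

/-- The `μ`-degree `𝔡_μ(b) = sup {n ∈ ℕ : Σ_μ(j_0(b) + 1, n) < e}`, in `ℕ ∪ {∞}`. -/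
noncomputable def weightDegree (μ : ℕ → ℝ) (b : ℝ) : ℕ∞ :=
  sSup {n : ℕ∞ | ∃ k : ℕ, n = k ∧ weightSum μ (startIndex b + 1) k < Real.exp 1}

/-- `(μ, K)` is admissible data with associated integer `N`: `μ` is an admissible weight, `K` is
compact, convex, with non-empty interior, `Σ_μ(1, ∞) > δ_K e` and `N = 𝔡_{δ_K μ}(1) + 1`,
where `δ_K` is the diameter of `K`. -/
structure IsAdmissibleData {d : ℕ} (μ : ℕ → ℝ) (K : ConvexBody (EuclideanSpace ℝ (Fin d)))
    (N : ℕ) : Prop where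
  weight : IsAdmissibleWeight μ
  interior_nonempty : (interior (K : Set (EuclideanSpace ℝ (Fin d)))).Nonempty
  sum_gt : ENNReal.ofReal (Metric.diam (K : Set (EuclideanSpace ℝ (Fin d))) * Real.exp 1)
    < weightSumTop μ 1
  assoc : (N : ℕ∞) =
    weightDegree (fun j => Metric.diam (K : Set (EuclideanSpace ℝ (Fin d))) * μ j) 1 + 1

/-- The partial derivative `∂_i g`. -/
noncomputable def partialDeriv {d : ℕ} (i : Fin d) (g : EuclideanSpace ℝ (Fin d) → ℝ) :
    EuclideanSpace ℝ (Fin d) → ℝ :=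
  fun x => fderiv ℝ g x (EuclideanSpace.single i 1)

/-- The partial derivative `f^{(α)} = ∂_1^{α_1} ⋯ ∂_d^{α_d} f`. -/
noncomputable def multiDeriv {d : ℕ} (α : Fin d → ℕ) (f : EuclideanSpace ℝ (Fin d) → ℝ) :
    EuclideanSpace ℝ (Fin d) → ℝ :=
  (List.finRange d).foldr (fun i g => (partialDeriv i)^[α i] g) f

/-- The sup-norm `‖g‖_K = sup_{x ∈ K} |g x|`. -/
noncomputable def supNorm {d : ℕ} (K : Set (EuclideanSpace ℝ (Fin d)))
    (g : EuclideanSpace ℝ (Fin d) → ℝ) : ℝ :=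
  ⨆ x : K, |g x|

/-- `‖f‖_{j,K} = ∑_{|α| = j} (j!/α!) ‖f^{(α)}‖_K`. -/
noncomputable def derivNorm {d : ℕ} (j : ℕ) (K : Set (EuclideanSpace ℝ (Fin d)))
    (f : EuclideanSpace ℝ (Fin d) → ℝ) : ℝ :=
  ∑ α ∈ Finset.piAntidiag (Finset.univ : Finset (Fin d)) j,
    ((j ! : ℝ) / ∏ i, ((α i)! : ℝ)) * supNorm K (multiDeriv α f)

/-- `f` is `(μ^{|n}, M₀)`-smooth on `K`: `f` is of class `C^n` on an open neighbourhood of `K` and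
`‖f‖_{j,K} ≤ M₀ μ_1 ⋯ μ_j` for `0 ≤ j ≤ n`, where `M₀ > 0`.
(The values of `f` away from `K` are irrelevant.) -/
structure IsWeightSmooth {d : ℕ} (μ : ℕ → ℝ) (n : ℕ) (M₀ : ℝ)
    (K : Set (EuclideanSpace ℝ (Fin d))) (f : EuclideanSpace ℝ (Fin d) → ℝ) : Prop where
  pos : 0 < M₀
  contDiff : ∃ U : Set (EuclideanSpace ℝ (Fin d)), IsOpen U ∧ K ⊆ U ∧ ContDiffOn ℝ n f U
  bound : ∀ j, j ≤ n → derivNorm j K f ≤ M₀ * ∏ i ∈ Finset.Icc 1 j, μ i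

/-- `ν : [1, ∞) → (0, ∞)` is continuous, increasing and piecewise `C^1`, and interpolates the
weight: `ν k = μ_k` for all integers `k ≥ 1`. -/
structure IsInterpolant (ν : ℝ → ℝ) (μ : ℕ → ℝ) : Prop where
  pos : ∀ s, 1 ≤ s → 0 < ν s
  mono : MonotoneOn ν (Ici 1)
  cont : ContinuousOn ν (Ici 1)
  piecewise : ∃ t : ℕ → ℝ, StrictMono t ∧ t 0 = 1 ∧ Tendsto t atTop atTop ∧
    ∀ k, ContDiffOn ℝ 1 ν (Icc (t k) (t (k + 1)))
  interp : ∀ k : ℕ, 1 ≤ k → ν k = μ k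

/-- The derivative of `ν : [1, ∞) → ℝ`, read as the left derivative for `s > 1` (at a point of
differentiability this is the derivative) and as the right derivative at the end point `1`. -/
noncomputable def sideDeriv (ν : ℝ → ℝ) (s : ℝ) : ℝ :=
  if s ≤ 1 then derivWithin ν (Ici s) s else derivWithin ν (Iic s) s

/-- `γ_ν(n) = sup_{1 ≤ s ≤ n} s ν'(s) / ν(s)`. -/
noncomputable def growthExponent (ν : ℝ → ℝ) (n : ℕ) : ℝ :=
  sSup ((fun s => s * sideDeriv ν s / ν s) '' Icc 1 (n : ℝ))

/-- `Γ_ν(n) = 4 e^{4 + γ_ν(n)}`. -/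
noncomputable def growthConst (ν : ℝ → ℝ) (n : ℕ) : ℝ :=
  4 * Real.exp (4 + growthExponent ν n)

/-- The constant `C_N = Γ_ν(2(N - 1))`. -/
noncomputable def remezConst (ν : ℝ → ℝ) (N : ℕ) : ℝ := growthConst ν (2 * (N - 1))

/-- The convention `C_N^{2(N-1)} = ∞` for `N = 1`: in that case a bound that contains this
constant is read as `∞`. -/
noncomputable def boundOrTop (N : ℕ) (B : ℝ≥0∞) : ℝ≥0∞ := if N = 1 then ⊤ else B

/-- The normalized `L^p`-norm `‖f‖^♯_{L^p(E)}`: it is `(|E|⁻¹ ∫_E |f|^p)^{1/p}` for `0 < p < ∞` and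
`ess sup_E |f|` for `p = ∞`. -/
noncomputable def normalizedLp {d : ℕ} (f : EuclideanSpace ℝ (Fin d) → ℝ) (p : ℝ≥0∞)
    (E : Set (EuclideanSpace ℝ (Fin d))) : ℝ≥0∞ :=
  eLpNorm f p ((volume E)⁻¹ • volume.restrict E)

/-! The core is the sup-norm case `supNorm_le_of_abs_le`: if |f| ≤ t on E, then ‖f‖_K ≤ (C_N
d|K|/|E|)^{2(N-1)} t. Take x₀ ∈ K where |f| is maximal. In polar coordinates about x₀, some segment
in K starting at x₀ meets E in a fraction at least |E|/(2d|K|) of its length L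
(`exists_segment_of_volume_pos`). Along it the directional derivatives of f obey the bounds A
μ_1⋯μ_j with A = ‖f‖_K, and L ≤ δ_K gives eL ≤ ∑_{j≤N} 1/μ_j.

The problem is now one-dimensional (`remez_interval`): |G(0)| = A is maximal and |G| ≤ ε on a set T;
suppose ε is too small. Let n be least with eL ≤ ∑_{j≤n+1} 1/μ_j, and let P interpolate G at n+1
well separated points of T. Minimality of n yields l! ≤ (eL)^l μ_1⋯μ_l for l ≤ n, so P satisfies the
same derivative bounds as G with A replaced by some κ ≤ A/20. Now G − P has n+1 zeros, and by Rolle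
its derivatives of orders 0,…,n vanish at increasing points. Bang's descent (`bang_descent`) then
forces e|(G − P)(0)| ≤ 2(A + κ), whereas |(G − P)(0)| ≥ A − κ: a contradiction.

For L^q, apply the sup-norm case to the sublevel sets of |f| in E. This bounds their measure by a
power of the level, and the layer-cake formula gives `supNorm_le_normalizedLp`. Interpolating L^p(K)
between L^q(K) and the sup-norm finishes the proof. -/

/-! ### Bang's descent -/

/-- Partial sums of the exponential series. -/
noncomputable def expPartialSum (q : ℕ) (u : ℝ) : ℝ :=
  ∑ r ∈ Finset.range (q + 1), u ^ r / (r ! : ℝ)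

theorem one_le_expPartialSum (q : ℕ) {u : ℝ} (hu : 0 ≤ u) : 1 ≤ expPartialSum q u := by
  have h := Finset.single_le_sum (f := fun r : ℕ => u ^ r / (r ! : ℝ))
    (s := Finset.range (q + 1)) (fun r _ => by positivity) (Finset.mem_range.2 (Nat.succ_pos q))
  simpa [expPartialSum] using h

theorem expPartialSum_mono (q : ℕ) {u v : ℝ} (hu : 0 ≤ u) (huv : u ≤ v) :
    expPartialSum q u ≤ expPartialSum q v := by
  unfold expPartialSum
  gcongr

theorem expPartialSum_le_exp (q : ℕ) {u : ℝ} (hu : 0 ≤ u) : expPartialSum q u ≤ Real.exp u :=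
  Real.sum_le_exp_of_nonneg hu _

theorem hasDerivAt_expPartialSum (q : ℕ) (u : ℝ) :
    HasDerivAt (expPartialSum (q + 1)) (expPartialSum q u) u := by
  have h : HasDerivAt (fun v : ℝ => ∑ r ∈ Finset.range (q + 1 + 1), v ^ r / (r ! : ℝ))
      (∑ r ∈ Finset.range (q + 1 + 1), ((r : ℝ) * u ^ (r - 1)) / (r ! : ℝ)) u :=
    HasDerivAt.fun_sum fun r _ => (hasDerivAt_pow r u).div_const _
  convert h using 1
  · rfl
  rw [Finset.sum_range_succ', expPartialSum]
  simp only [Nat.cast_zero, zero_mul, zero_div, add_zero]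
  refine Finset.sum_congr rfl fun r _ => ?_
  rw [Nat.factorial_succ, Nat.add_sub_cancel]
  push_cast
  field_simp

theorem prod_Icc_weight_pos {μ : ℕ → ℝ} (hμ : IsAdmissibleWeight μ) (l : ℕ) :
    0 < ∏ i ∈ Finset.Icc 1 l, μ i :=
  Finset.prod_pos fun i hi => hμ.pos i (Finset.mem_Icc.1 hi).1

theorem IsAdmissibleWeight.le_of_le {μ : ℕ → ℝ} (hμ : IsAdmissibleWeight μ) {i j : ℕ}
    (hi : 1 ≤ i) (hij : i ≤ j) : μ i ≤ μ j := by
  induction j, hij using Nat.le_induction with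
  | base => exact le_rfl
  | succ j hj ih => exact ih.trans (hμ.mono j (hi.trans hj))

/-- If `|h z| ≤ g z` and `|h'| ≤ -g'` on `[x, z]` then `|h x| ≤ g x`. -/
theorem abs_le_of_abs_deriv_le_neg_deriv {h h' g g' : ℝ → ℝ} {x z : ℝ} (hxz : x ≤ z)
    (hh : ∀ s ∈ Icc x z, HasDerivAt h (h' s) s) (hg : ∀ s ∈ Icc x z, HasDerivAt g (g' s) s)
    (hle : ∀ s ∈ Icc x z, |h' s| ≤ -g' s) (hz : |h z| ≤ g z) : |h x| ≤ g x := by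
  have key : ∀ c : ℝ, |c| = 1 → g z + c * h z ≤ g x + c * h x := by
    intro c hc
    have hd : ∀ s ∈ Icc x z, HasDerivAt (fun s => g s + c * h s) (g' s + c * h' s) s :=
      fun s hs => (hg s hs).add ((hh s hs).const_mul c)
    have := antitoneOn_of_deriv_nonpos (convex_Icc x z)
      (fun s hs => (hd s hs).continuousAt.continuousWithinAt)
      (fun s hs => (hd s (interior_subset hs)).differentiableAt.differentiableWithinAt)
      (fun s hs => by
        rw [(hd s (interior_subset hs)).deriv]
        have h1 := hle s (interior_subset hs)
        have h2 : c * h' s ≤ |h' s| := by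
          calc c * h' s ≤ |c * h' s| := le_abs_self _
            _ = |h' s| := by rw [abs_mul, hc, one_mul]
        linarith)
    exact this (left_mem_Icc.2 hxz) (right_mem_Icc.2 hxz) hxz
  have h1 := key 1 (by simp)
  have h2 := key (-1) (by simp)
  rw [abs_le] at hz ⊢
  constructor <;> linarith [hz.1, hz.2]

section Descent

variable {k : ℕ} {L A : ℝ} {H : ℕ → ℝ → ℝ} {μ y : ℕ → ℝ}

/-- The bounds are integrated leftwards from b, one order at a time from i down to l. Partial
exponential sums differentiate into each other, which closes the induction, and the gain e^{l-i}
assumed at b survives up to such a factor. -/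
theorem bang_local (hμ : IsAdmissibleWeight μ)
    (hder : ∀ l < k, ∀ x ∈ Icc 0 L, HasDerivAt (H l) (H (l + 1) x) x)
    (hbd : ∀ l ≤ k, ∀ x ∈ Icc 0 L, |H l x| ≤ A * ∏ i ∈ Finset.Icc 1 l, μ i)
    (hymono : ∀ l, l + 1 < k → y l ≤ y (l + 1))
    (hzero : ∀ l < k, H l (y l) = 0) (hA : 0 ≤ A)
    {i : ℕ} (hi : 1 ≤ i) (hik : i ≤ k) {b : ℝ} (hb : b ∈ Icc 0 L)
    (hstart : ∀ l < i, b ≤ y l →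
      |H l b| * Real.exp 1 ^ i ≤ A * Real.exp 1 ^ l * ∏ j ∈ Finset.Icc 1 l, μ j) :
    ∀ q l, l + q = i → ∀ x ∈ Icc 0 b, (l < i → x ≤ y l) →
      |H l x| * Real.exp 1 ^ i ≤ A * Real.exp 1 ^ l * (∏ j ∈ Finset.Icc 1 l, μ j) *
        expPartialSum q (Real.exp 1 * μ i * (b - x)) := by
  intro q
  have he : 0 < Real.exp 1 := Real.exp_pos 1
  have hμi : 0 < μ i := hμ.pos i hi
  induction q with
  | zero =>
    intro l hl x hx _
    obtain rfl : l = i := by omega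
    have := hbd l hik x ⟨hx.1, hx.2.trans hb.2⟩
    simp only [expPartialSum, zero_add, Finset.range_one, Finset.sum_singleton, pow_zero,
      Nat.factorial_zero, Nat.cast_one, div_one, mul_one]
    calc |H l x| * Real.exp 1 ^ l ≤ (A * ∏ i ∈ Finset.Icc 1 l, μ i) * Real.exp 1 ^ l := by gcongr
      _ = _ := by ring
  | succ q ih =>
    intro l hl x hx hxy
    have hli : l < i := by omega
    have hlk : l < k := by omega
    set D : ℝ := A * Real.exp 1 ^ l * ∏ j ∈ Finset.Icc 1 l, μ j with hD
    have hM := prod_Icc_weight_pos hμ l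
    have hD0 : 0 ≤ D := by positivity
    -- H l is integrated from its own zero if that comes before b, otherwise from b, where `hstart`
    -- applies. Since z ≤ y l ≤ y (l + 1), the bound for order l + 1 is available on all of [x, z].
    set z := min (y l) b with hz
    have hxz : x ≤ z := le_min (hxy hli) hx.2
    have hzb : z ≤ b := min_le_right _ _
    set c := Real.exp 1 * μ i with hc
    have hc0 : 0 < c := by positivity
    have hmain := abs_le_of_abs_deriv_le_neg_deriv (x := x) (z := z)
      (h := fun s => H l s * Real.exp 1 ^ i) (h' := fun s => H (l + 1) s * Real.exp 1 ^ i)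
      (g := fun s => D * expPartialSum (q + 1) (c * (b - s)))
      (g' := fun s => D * (expPartialSum q (c * (b - s)) * (c * (0 - 1)))) hxz
      (fun s hs => (hder l hlk s ⟨hx.1.trans hs.1, hs.2.trans (hzb.trans hb.2)⟩).mul_const _)
      (fun s hs => ((hasDerivAt_expPartialSum q _).comp s
        (((hasDerivAt_const s b).sub (hasDerivAt_id s)).const_mul c)).const_mul D)
      (fun s hs => by
        have h1 := ih (l + 1) (by omega) s ⟨hx.1.trans hs.1, hs.2.trans hzb⟩
          (fun h => (hs.2.trans (min_le_left _ _)).trans (hymono l (by omega)))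
        rw [abs_mul, abs_of_pos (pow_pos he i)]
        refine h1.trans ?_
        rw [Finset.prod_Icc_succ_top (by omega)]
        have h2 : μ (l + 1) ≤ μ i := hμ.le_of_le (by omega) (by omega)
        have h3 : 0 ≤ expPartialSum q (c * (b - s)) :=
          zero_le_one.trans (one_le_expPartialSum q
            (mul_nonneg hc0.le (by linarith [hs.2.trans hzb])))
        calc A * Real.exp 1 ^ (l + 1) * ((∏ j ∈ Finset.Icc 1 l, μ j) * μ (l + 1)) *
              expPartialSum q (c * (b - s))
            = D * Real.exp 1 * μ (l + 1) * expPartialSum q (c * (b - s)) := by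
              rw [hD]; ring
          _ ≤ D * Real.exp 1 * μ i * expPartialSum q (c * (b - s)) := by gcongr
          _ = _ := by rw [hc]; ring)
      (by
        have h3 : 1 ≤ expPartialSum (q + 1) (c * (b - z)) :=
          one_le_expPartialSum _ (mul_nonneg hc0.le (by linarith))
        rw [abs_mul, abs_of_pos (pow_pos he i)]
        rcases le_total (y l) b with h | h
        · have : z = y l := min_eq_left h
          rw [this] at h3 ⊢
          rw [hzero l hlk, abs_zero, zero_mul]
          exact mul_nonneg hD0 (zero_le_one.trans h3)
        · have : z = b := min_eq_right h
          rw [this] at h3 ⊢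
          exact (hstart l hli h).trans (le_mul_of_one_le_right hD0 h3))
    simpa only [abs_mul, abs_of_pos (pow_pos he i)] using hmain

/-- Bang's descent: a function whose successive derivatives vanish at increasing points of
`[0, L]` and are controlled by a weight with `∑ 1/μ_j ≥ e L` is small at the left end point. -/
theorem bang_descent (hμ : IsAdmissibleWeight μ) (hk : 1 ≤ k)
    (hder : ∀ l < k, ∀ x ∈ Icc 0 L, HasDerivAt (H l) (H (l + 1) x) x)
    (hbd : ∀ l ≤ k, ∀ x ∈ Icc 0 L, |H l x| ≤ A * ∏ i ∈ Finset.Icc 1 l, μ i)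
    (hymono : ∀ l, l + 1 < k → y l ≤ y (l + 1)) (hy : ∀ l < k, y l ∈ Icc 0 L)
    (hzero : ∀ l < k, H l (y l) = 0)
    (hsum : Real.exp 1 * L ≤ weightSum μ 1 k) : |H 0 0| * Real.exp 1 ≤ 2 * A := by
  have he : 0 < Real.exp 1 := Real.exp_pos 1
  have hL : 0 ≤ L := (hy 0 (by omega)).1.trans (hy 0 (by omega)).2
  have hA : 0 ≤ A := by
    have := hbd 0 (by omega) 0 ⟨le_rfl, hL⟩
    simpa using (abs_nonneg _).trans this
  -- Here a k = L, and `hsum` puts a 0 ≤ 0. The spacing 1/(e μ_i) is the length over which the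
  -- argument e μ_i (b − x) of `bang_local` grows from 0 to 1.
  set a : ℕ → ℝ := fun i => L - weightSum μ (i + 1) k / Real.exp 1 with ha
  have hak : ∀ i, i ≤ k → a i ≤ L := by
    intro i _
    have : 0 ≤ weightSum μ (i + 1) k := Finset.sum_nonneg fun j hj =>
      (one_div_pos.2 (hμ.pos j (by have := (Finset.mem_Icc.1 hj).1; omega))).le
    have := div_nonneg this he.le
    simp only [ha]; linarith
  have hstep : ∀ i, 1 ≤ i → i ≤ k → a i - a (i - 1) = 1 / (Real.exp 1 * μ i) := by
    intro i hi hik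
    obtain ⟨j, rfl⟩ : ∃ j, i = j + 1 := ⟨i - 1, by omega⟩
    have : weightSum μ (j + 1) k = 1 / μ (j + 1) + weightSum μ (j + 1 + 1) k := by
      unfold weightSum
      rw [← Finset.add_sum_Ioc_eq_sum_Icc hik, Finset.Icc_add_one_left_eq_Ioc]
    simp only [ha, Nat.add_sub_cancel, this]
    have := hμ.pos (j + 1) hi
    field_simp
    ring
  have hM := prod_Icc_weight_pos hμ
  have hstepbound : ∀ i, 1 ≤ i → i ≤ k →
      (∀ x ∈ Icc 0 L, a i ≤ x → ∀ l < i, x ≤ y l →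
        |H l x| * Real.exp 1 ^ i ≤ A * Real.exp 1 ^ l * ∏ j ∈ Finset.Icc 1 l, μ j) →
      ∀ x ∈ Icc 0 L, a (i - 1) ≤ x → ∀ l < i, x ≤ y l →
        |H l x| * Real.exp 1 ^ i ≤ A * Real.exp 1 ^ l * (∏ j ∈ Finset.Icc 1 l, μ j) *
          expPartialSum (i - l) 1 := by
    intro i hi hik hC x hx hax l hl hxy
    have hMl := hM l
    have hμi := hμ.pos i hi
    rcases le_total (a i) x with h | h
    · exact (hC x hx h l hl hxy).trans
        (le_mul_of_one_le_right (by positivity) (one_le_expPartialSum _ zero_le_one))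
    · have hb : a i ∈ Icc 0 L := ⟨hx.1.trans h, hak i hik⟩
      refine (bang_local hμ hder hbd hymono hzero hA hi hik hb (hC _ hb le_rfl) (i - l) l
        (by omega) x ⟨hx.1, h⟩ (fun _ => hxy)).trans ?_
      refine mul_le_mul_of_nonneg_left (expPartialSum_mono _ ?_ ?_) (by positivity)
      · exact mul_nonneg (by positivity) (by linarith)
      · have h1 : a i - x ≤ 1 / (Real.exp 1 * μ i) := by linarith [hstep i hi hik]
        calc Real.exp 1 * μ i * (a i - x) ≤ Real.exp 1 * μ i * (1 / (Real.exp 1 * μ i)) := by gcongr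
          _ = 1 := by field_simp
  -- Downward induction on i: crossing from a (i + 1) to a i costs a partial exponential sum at 1,
  -- hence at most e, which is paid for by weakening e^{-(i+1)} to e^{-i}.
  have hC : ∀ m i, i + m = k → 1 ≤ i → ∀ x ∈ Icc 0 L, a i ≤ x → ∀ l < i, x ≤ y l →
      |H l x| * Real.exp 1 ^ i ≤ A * Real.exp 1 ^ l * ∏ j ∈ Finset.Icc 1 l, μ j := by
    intro m
    induction m with
    | zero =>
      intro i hi h1 x hx hax l hl hxy
      obtain rfl : i = k := by omega
      have hai : a i = L := by simp [ha, weightSum]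
      have hyl : y l = x := le_antisymm ((hy l hl).2.trans (hai ▸ hax)) hxy
      rw [← hyl, hzero l hl]
      have := hM l
      simp only [abs_zero, zero_mul]
      positivity
    | succ m ih =>
      intro i hi h1 x hx hax l hl hxy
      have h := hstepbound (i + 1) (by omega) (by omega) (ih (i + 1) (by omega) (by omega)) x hx
        (by simpa using hax) l (by omega) hxy
      have hMl := hM l
      have h2 : |H l x| * Real.exp 1 ^ (i + 1) ≤
          A * Real.exp 1 ^ l * (∏ j ∈ Finset.Icc 1 l, μ j) * Real.exp 1 := by
        refine h.trans (mul_le_mul_of_nonneg_left ?_ (by positivity))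
        exact expPartialSum_le_exp _ zero_le_one
      rw [pow_succ, ← mul_assoc] at h2
      exact le_of_mul_le_mul_right h2 he
  have h0 : (0 : ℝ) ∈ Icc 0 L := ⟨le_rfl, hL⟩
  have := hstepbound 1 le_rfl hk (hC (k - 1) 1 (by omega) le_rfl) 0 h0
    (by
      simp only [ha, Nat.sub_self, zero_add, sub_nonpos]
      rwa [le_div_iff₀ he, mul_comm]) 0 (by omega) (hy 0 (by omega)).1
  -- In the last interval the crude factor e would only return |H 0 0| ≤ A. The actual sum 1 + 1 = 2
  -- is smaller than e, and this is the whole gain.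
  have h2 : expPartialSum 1 1 = 2 := by
    norm_num [expPartialSum, Finset.sum_range_succ]
  simp only [Nat.sub_zero, h2, pow_one, pow_zero] at this
  simpa [mul_comm] using this

end Descent

/-! ### Zeros of derivatives, separated nodes and Lagrange interpolation -/

/-- Iterating Rolle's theorem along the smallest zeros of the successive derivatives. -/
theorem exists_zeros_of_derivs {L : ℝ} : ∀ (k : ℕ) (H : ℕ → ℝ → ℝ) (z : ℕ → ℝ),
    (∀ l < k, ∀ x ∈ Icc 0 L, HasDerivAt (H l) (H (l + 1) x) x) →
    (∀ i, i + 1 < k → z i < z (i + 1)) → (∀ i < k, z i ∈ Icc 0 L) → (∀ i < k, H 0 (z i) = 0) →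
    ∃ y : ℕ → ℝ, y 0 = z 0 ∧ (∀ l, l + 1 < k → y l ≤ y (l + 1)) ∧ (∀ l < k, y l ∈ Icc 0 L) ∧
      ∀ l < k, H l (y l) = 0 := by
  intro k
  induction k with
  | zero => intro H z _ _ _ _; exact ⟨z, rfl, by simp, by simp, by simp⟩
  | succ k ih =>
    intro H z hder hz hzI hH
    have hR : ∀ i, ∃ w, i < k → w ∈ Ioo (z i) (z (i + 1)) ∧ H 1 w = 0 := by
      intro i
      by_cases hi : i < k
      · have hsub : Icc (z i) (z (i + 1)) ⊆ Icc 0 L :=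
          Icc_subset_Icc (hzI i (by omega)).1 (hzI (i + 1) (by omega)).2
        obtain ⟨w, hw, hw0⟩ := exists_hasDerivAt_eq_zero (f := H 0) (f' := H 1) (hz i (by omega))
          (fun x hx => (hder 0 (by omega) x (hsub hx)).continuousAt.continuousWithinAt)
          (by rw [hH i (by omega), hH (i + 1) (by omega)])
          (fun x hx => hder 0 (by omega) x (hsub (Ioo_subset_Icc_self hx)))
        exact ⟨w, fun _ => ⟨hw, hw0⟩⟩
      · exact ⟨0, fun h => absurd h hi⟩
    choose w hw using hR
    obtain ⟨y, hy0, hymono, hyI, hyz⟩ := ih (fun l => H (l + 1)) w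
      (fun l hl x hx => hder (l + 1) (by omega) x hx)
      (fun i hi => (hw i (by omega)).1.2.trans (hw (i + 1) (by omega)).1.1)
      (fun i hi => ⟨(hzI i (by omega)).1.trans (hw i hi).1.1.le,
        (hw i hi).1.2.le.trans (hzI (i + 1) (by omega)).2⟩)
      (fun i hi => (hw i hi).2)
    -- The clause y 0 = z 0 is carried through the induction for this point: the next sequence
    -- starts at the Rolle point w 0, which lies to the right of z 0.
    refine ⟨fun l => Nat.casesOn l (z 0) y, rfl, ?_, ?_, ?_⟩
    · rintro (_ | l) hl
      · change z 0 ≤ y 0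
        rw [hy0]
        exact (hw 0 (by omega)).1.1.le
      · exact hymono l (by omega)
    · rintro (_ | l) hl
      · exact hzI 0 (by omega)
      · exact hyI l (by omega)
    · rintro (_ | l) hl
      · exact hH 0 (by omega)
      · exact hyz l (by omega)

/-- A set of reals of measure more than `k h` contains `k + 1` points with gaps at least `h`. -/
theorem exists_separated_points {h : ℝ} (hh : 0 < h) : ∀ (k : ℕ) (T : Set ℝ), BddBelow T →
    ENNReal.ofReal (k * h) < volume T →
    ∃ z : ℕ → ℝ, (∀ i ≤ k, z i ∈ T) ∧ ∀ i < k, z i + h ≤ z (i + 1) := by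
  intro k
  induction k with
  | zero =>
    intro T _ hT
    obtain ⟨x, hx⟩ : T.Nonempty := nonempty_of_measure_ne_zero (pos_of_gt hT).ne'
    exact ⟨fun _ => x, fun _ _ => hx, by simp⟩
  | succ k ih =>
    intro T hb hT
    have hne : T.Nonempty := nonempty_of_measure_ne_zero (pos_of_gt hT).ne'
    obtain ⟨r, hr0, hr1, hr2⟩ := ENNReal.lt_iff_exists_real_btwn.1 hT
    have hr : ((k + 1 : ℕ) : ℝ) * h < r := (ENNReal.ofReal_lt_ofReal_iff_of_nonneg (by positivity)).1 hr1
    push_cast at hr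
    -- Greedy choice: x is so close to inf T that [inf T, x + h] is shorter than r − k h, which
    -- leaves measure more than k h to the right of x + h.
    obtain ⟨x, hxT, hx⟩ := exists_lt_of_csInf_lt hne
      (show sInf T < sInf T + (r - (k + 1) * h) by linarith)
    have hcover : T ⊆ Icc (sInf T) (x + h) ∪ (T ∩ Ici (x + h)) := by
      intro t ht
      rcases le_total t (x + h) with h1 | h1
      · exact Or.inl ⟨csInf_le hb ht, h1⟩
      · exact Or.inr ⟨ht, h1⟩
    have hT' : ENNReal.ofReal (k * h) < volume (T ∩ Ici (x + h)) := by
      by_contra! hcon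
      refine hr2.not_ge ?_
      calc volume T ≤ volume (Icc (sInf T) (x + h)) + volume (T ∩ Ici (x + h)) :=
            (measure_mono hcover).trans (measure_union_le _ _)
        _ ≤ ENNReal.ofReal (x + h - sInf T) + ENNReal.ofReal (k * h) := by
            rw [Real.volume_Icc]; gcongr
        _ = ENNReal.ofReal (x + h - sInf T + k * h) :=
            (ENNReal.ofReal_add (by linarith [csInf_le hb hxT]) (by positivity)).symm
        _ ≤ ENNReal.ofReal r := ENNReal.ofReal_le_ofReal (by linarith)
    obtain ⟨z, hz, hzgap⟩ := ih _ (hb.mono inter_subset_left) hT'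
    refine ⟨fun i => Nat.casesOn i x z, ?_, ?_⟩
    · rintro (_ | i) hi
      · exact hxT
      · exact (hz i (by omega)).1
    · rintro (_ | i) hi
      · exact (hz 0 (by omega)).2
      · exact hzgap i (by omega)

theorem add_mul_le_of_gaps {z : ℕ → ℝ} {h : ℝ} {n : ℕ} (hz : ∀ i < n, z i + h ≤ z (i + 1))
    {i : ℕ} : ∀ j, i ≤ j → j ≤ n → z i + (j - i : ℝ) * h ≤ z j := by
  intro j hij
  induction j, hij using Nat.le_induction with
  | base => intro _; simp
  | succ j hj ih =>
    intro hn
    have := ih (by omega)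
    have := hz j (by omega)
    push_cast
    linarith

theorem mul_abs_sub_le_of_gaps {z : ℕ → ℝ} {h : ℝ} {n : ℕ} (hz : ∀ i < n, z i + h ≤ z (i + 1))
    {i j : ℕ} (hi : i ≤ n) (hj : j ≤ n) : h * |(i : ℝ) - j| ≤ |z i - z j| := by
  rcases le_total i j with hij | hij
  · have h1 := add_mul_le_of_gaps hz j hij hj
    have h2 : (i : ℝ) ≤ j := by exact_mod_cast hij
    rw [abs_sub_comm (z i), abs_of_nonpos (sub_nonpos.2 h2)]
    exact le_trans (by linarith) (le_abs_self _)
  · have h1 := add_mul_le_of_gaps hz i hij hi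
    have h2 : (j : ℝ) ≤ i := by exact_mod_cast hij
    rw [abs_of_nonneg (sub_nonneg.2 h2)]
    exact le_trans (by linarith) (le_abs_self _)

/-- This is the Lagrange denominator for the model nodes 0, …, n; nodes with gaps at least h are
compared with it. -/
theorem prod_erase_abs_sub_eq (i : ℕ) : ∀ n, i ≤ n →
    ∏ l ∈ (Finset.range (n + 1)).erase i, |(i : ℝ) - l| = (i ! : ℝ) * ((n - i)! : ℝ) := by
  intro n hn
  induction n, hn using Nat.le_induction with
  | base =>
    rw [Finset.range_add_one, Finset.erase_insert (by simp), Nat.sub_self, Nat.factorial_zero,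
      Nat.cast_one, mul_one, ← Finset.prod_range_add_one_eq_factorial, ← Finset.prod_range_reflect]
    push_cast
    refine Finset.prod_congr rfl fun l hl => ?_
    have := Finset.mem_range.1 hl
    rw [abs_of_nonneg (sub_nonneg.2 (by exact_mod_cast (by omega : i - 1 - l ≤ i))), Nat.sub_sub,
      Nat.cast_sub (by omega)]
    push_cast
    ring
  | succ n hn ih =>
    rw [Finset.range_add_one, Finset.erase_insert_of_ne (by omega), Finset.prod_insert (by simp), ih,
      show n + 1 - i = (n - i) + 1 by omega, Nat.factorial_succ, abs_sub_comm,
      abs_of_nonneg (sub_nonneg.2 (by exact_mod_cast (by omega : i ≤ n + 1)))]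
    push_cast [Nat.cast_sub hn]
    ring

open Polynomial in
-- Shifting turns each factor into X + (x − a_l), whose coefficients weighted by powers of σ sum to
-- at most L + σ in absolute value. Multiplying by it enlarges the largest weighted coefficient by
-- at most that factor.
theorem abs_coeff_taylor_prod_le {ι : Type*} [DecidableEq ι] (s : Finset ι) (a : ι → ℝ)
    {x L σ : ℝ} (hL : 0 ≤ L) (hσ : 0 ≤ σ) (ha : ∀ l ∈ s, |x - a l| ≤ L) (j : ℕ) :
    |(taylor x (∏ l ∈ s, (X - C (a l)))).coeff j| * σ ^ j ≤ (L + σ) ^ s.card := by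
  induction s using Finset.induction_on generalizing j with
  | empty =>
    rw [Finset.prod_empty, taylor_one, Finset.card_empty, pow_zero, coeff_C]
    split_ifs with h
    · simp [h]
    · simp
  | insert i s hi ih =>
    have ih' := ih fun l hl => ha l (Finset.mem_insert_of_mem hl)
    have hai := ha i (Finset.mem_insert_self i s)
    rw [Finset.prod_insert hi, taylor_mul, Finset.card_insert_of_notMem hi, map_sub, taylor_X,
      taylor_C, show (X + C x - C (a i) : ℝ[X]) = X + C (x - a i) by rw [C_sub]; ring, add_mul]
    set Q := taylor x (∏ l ∈ s, (X - C (a l)))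
    have h2 : |(x - a i) * Q.coeff j| * σ ^ j ≤ L * (L + σ) ^ s.card := by
      rw [abs_mul, mul_assoc]
      exact mul_le_mul hai (ih' j) (by positivity) hL
    rw [coeff_add, coeff_C_mul]
    cases j with
    | zero =>
      rw [coeff_X_mul_zero, zero_add]
      refine h2.trans ?_
      rw [pow_succ']
      gcongr
      linarith
    | succ j =>
      rw [coeff_X_mul]
      calc |Q.coeff j + (x - a i) * Q.coeff (j + 1)| * σ ^ (j + 1)
          ≤ (|Q.coeff j| + |(x - a i) * Q.coeff (j + 1)|) * σ ^ (j + 1) := by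
            gcongr
            exact abs_add_le _ _
        _ = σ * (|Q.coeff j| * σ ^ j) + |(x - a i) * Q.coeff (j + 1)| * σ ^ (j + 1) := by ring
        _ ≤ σ * (L + σ) ^ s.card + L * (L + σ) ^ s.card := by
            gcongr
            exact ih' j
        _ = _ := by ring

open Polynomial in
/-- The Taylor coefficients of the Lagrange interpolant of data bounded by `ε`. -/
theorem abs_coeff_taylor_interpolate_le {z r : ℕ → ℝ} {h L σ ε x : ℝ} {n : ℕ} (hh : 0 < h)
    (hz : ∀ i < n, z i + h ≤ z (i + 1)) (hL : 0 ≤ L) (hσ : 0 ≤ σ)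
    (hx : ∀ i ≤ n, |x - z i| ≤ L) (hr : ∀ i ≤ n, |r i| ≤ ε) (j : ℕ) :
    |(taylor x (Lagrange.interpolate (Finset.range (n + 1)) z r)).coeff j| * σ ^ j ≤
      ε * ((L + σ) / h) ^ n * (2 ^ n / (n ! : ℝ)) := by
  have hbasis : ∀ i ∈ Finset.range (n + 1),
      |(taylor x (Lagrange.basis (Finset.range (n + 1)) z i)).coeff j| * σ ^ j ≤
        ((L + σ) / h) ^ n * (1 / ((i ! : ℝ) * ((n - i)! : ℝ))) := by
    intro i hi
    have hin : i ≤ n := by have := Finset.mem_range.1 hi; omega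
    have hcard : ((Finset.range (n + 1)).erase i).card = n := by
      rw [Finset.card_erase_of_mem hi, Finset.card_range, Nat.add_sub_cancel]
    -- As |z_i − z_l| ≥ h|i − l|, the denominators are at least h^n i!(n − i)!; by the binomial
    -- theorem their reciprocals sum to at most h^{-n} 2^n/n!.
    have hden : h ^ n * ((i ! : ℝ) * ((n - i)! : ℝ)) ≤
        ∏ l ∈ (Finset.range (n + 1)).erase i, |z i - z l| := by
      rw [← prod_erase_abs_sub_eq i n hin]
      nth_rewrite 1 [← hcard]
      rw [← Finset.prod_const, ← Finset.prod_mul_distrib]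
      refine Finset.prod_le_prod (fun l _ => by positivity) fun l hl => ?_
      have := Finset.mem_range.1 (Finset.mem_of_mem_erase hl)
      exact mul_abs_sub_le_of_gaps hz hin (by omega)
    have hnum := abs_coeff_taylor_prod_le ((Finset.range (n + 1)).erase i) z hL hσ
      (fun l hl => hx l (by have := Finset.mem_range.1 (Finset.mem_of_mem_erase hl); omega)) j
    rw [hcard] at hnum
    have heq : Lagrange.basis (Finset.range (n + 1)) z i =
        C (∏ l ∈ (Finset.range (n + 1)).erase i, (z i - z l)⁻¹) *
          ∏ l ∈ (Finset.range (n + 1)).erase i, (X - C (z l)) := by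
      rw [Lagrange.basis, map_prod, ← Finset.prod_mul_distrib]
      rfl
    rw [heq, taylor_mul, taylor_C, coeff_C_mul, abs_mul, Finset.abs_prod, mul_assoc]
    simp only [abs_inv]
    rw [Finset.prod_inv_distrib]
    have hpos : 0 < h ^ n * ((i ! : ℝ) * ((n - i)! : ℝ)) := by positivity
    calc _ ≤ (h ^ n * ((i ! : ℝ) * ((n - i)! : ℝ)))⁻¹ * (L + σ) ^ n := by gcongr
      _ = _ := by rw [div_pow]; field_simp
  have hsum : ∑ i ∈ Finset.range (n + 1), (1 / ((i ! : ℝ) * ((n - i)! : ℝ))) = 2 ^ n / (n ! : ℝ) := by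
    rw [eq_div_iff (by positivity), Finset.sum_mul]
    have := Nat.sum_range_choose n
    have h2 : ((∑ m ∈ Finset.range (n + 1), n.choose m : ℕ) : ℝ) = 2 ^ n := by
      rw [this]; norm_num
    rw [← h2]
    push_cast
    refine Finset.sum_congr rfl fun i hi => ?_
    rw [Nat.cast_choose ℝ (by have := Finset.mem_range.1 hi; omega)]
    ring
  have hε : 0 ≤ ε := (abs_nonneg _).trans (hr 0 (Nat.zero_le n))
  rw [Lagrange.interpolate_apply, map_sum, finsetSum_coeff]
  calc _ ≤ (∑ i ∈ Finset.range (n + 1),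
        |(taylor x (C (r i) * Lagrange.basis (Finset.range (n + 1)) z i)).coeff j|) * σ ^ j := by
        gcongr
        exact Finset.abs_sum_le_sum_abs _ _
    _ ≤ ∑ i ∈ Finset.range (n + 1), ε * (((L + σ) / h) ^ n * (1 / ((i ! : ℝ) * ((n - i)! : ℝ)))) := by
        rw [Finset.sum_mul]
        refine Finset.sum_le_sum fun i hi => ?_
        rw [taylor_mul, taylor_C, coeff_C_mul, abs_mul, mul_assoc]
        exact mul_le_mul (hr i (by have := Finset.mem_range.1 hi; omega)) (hbasis i hi)
          (by positivity) hε
    _ = _ := by rw [← Finset.mul_sum, ← Finset.mul_sum, hsum, mul_assoc]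

/-! ### The one-variable Remez inequality -/

theorem weightSum_le_of_le {μ : ℕ → ℝ} (hμ : IsAdmissibleWeight μ) {m n : ℕ} (h : m ≤ n) :
    weightSum μ 1 m ≤ weightSum μ 1 n :=
  Finset.sum_le_sum_of_subset_of_nonneg (Finset.Icc_subset_Icc_right h) fun j hj _ =>
    (one_div_pos.2 (hμ.pos j (Finset.mem_Icc.1 hj).1)).le

/-- Since μ increases, i/μ_i ≤ ∑_{j≤i} 1/μ_j ≤ c, so i ≤ c μ_i; multiply over i ≤ l. -/
theorem factorial_le_prod_weight {μ : ℕ → ℝ} (hμ : IsAdmissibleWeight μ) {n : ℕ} {c : ℝ}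
    (hc : weightSum μ 1 n < c) {l : ℕ} (hl : l ≤ n) :
    (l ! : ℝ) ≤ c ^ l * ∏ i ∈ Finset.Icc 1 l, μ i := by
  have hc0 : 0 ≤ c := (weightSum_le_of_le hμ (Nat.zero_le n)).trans hc.le |>.trans' (by simp [weightSum])
  have h1 : (l ! : ℝ) = ∏ i ∈ Finset.Icc 1 l, (i : ℝ) := by
    clear hl
    induction l with
    | zero => simp
    | succ l ih =>
      rw [Finset.prod_Icc_succ_top (by omega), ← ih, Nat.factorial_succ]
      push_cast
      ring
  have h2 : c ^ l = ∏ _i ∈ Finset.Icc 1 l, c := by simp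
  rw [h1, h2, ← Finset.prod_mul_distrib]
  refine Finset.prod_le_prod (fun _ _ => Nat.cast_nonneg _) fun i hi => ?_
  obtain ⟨hi1, hil⟩ := Finset.mem_Icc.1 hi
  have hμi := hμ.pos i hi1
  have h3 : (i : ℝ) * (1 / μ i) ≤ weightSum μ 1 i := by
    have : ∑ _j ∈ Finset.Icc 1 i, 1 / μ i ≤ weightSum μ 1 i :=
      Finset.sum_le_sum fun j hj => one_div_le_one_div_of_le
        (hμ.pos j (Finset.mem_Icc.1 hj).1)
        (hμ.le_of_le (Finset.mem_Icc.1 hj).1 (Finset.mem_Icc.1 hj).2)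
    simpa using this
  have h4 := (h3.trans (weightSum_le_of_le hμ (hil.trans hl))).trans hc.le
  rwa [mul_one_div, div_le_iff₀ hμi] at h4

/-- A Remez inequality in one variable for functions attaining their maximum at the left
end point. -/
theorem remez_interval {μ : ℕ → ℝ} (hμ : IsAdmissibleWeight μ) {n₀ : ℕ} (hn₀ : 1 ≤ n₀)
    {L A m ε : ℝ} (hL : 0 < L) (hsum : Real.exp 1 * L ≤ weightSum μ 1 (n₀ + 1)) (hA : 0 < A)
    {G : ℕ → ℝ → ℝ} (hder : ∀ l < 2 * n₀, ∀ x ∈ Icc 0 L, HasDerivAt (G l) (G (l + 1) x) x)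
    (hbd : ∀ l ≤ 2 * n₀, ∀ x ∈ Icc 0 L, |G l x| ≤ A * ∏ i ∈ Finset.Icc 1 l, μ i)
    (h0 : |G 0 0| = A) {T : Set ℝ} (hTL : T ⊆ Icc 0 L) (hm : 0 < m)
    (hmT : ENNReal.ofReal m ≤ volume T) (hT : ∀ x ∈ T, |G 0 x| ≤ ε) :
    A ≤ (2 * Real.exp 4 * (L / m)) ^ (2 * n₀) * ε := by
  by_contra! hcon
  have hTpos : 0 < volume T := (ENNReal.ofReal_pos.2 hm).trans_le hmT
  have hε : 0 ≤ ε := by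
    obtain ⟨x, hx⟩ : T.Nonempty := nonempty_of_measure_ne_zero hTpos.ne'
    exact (abs_nonneg _).trans (hT x hx)
  have hmL : 1 ≤ L / m := by
    rw [le_div_iff₀ hm, one_mul]
    have := hmT.trans (measure_mono hTL)
    rw [Real.volume_Icc, sub_zero] at this
    exact (ENNReal.ofReal_le_ofReal_iff hL.le).1 this
  set e := Real.exp 1 with he
  have he1 : 2.7 < e := by have := Real.exp_one_gt_d9; linarith
  have he2 : e < 2.72 := by have := Real.exp_one_lt_d9; linarith
  have he4 : Real.exp 4 = e ^ 4 := by rw [he, ← Real.exp_nat_mul]; norm_num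
  have hex : ∃ n, e * L ≤ weightSum μ 1 (n + 1) := ⟨n₀, hsum⟩
  classical
  -- Minimality serves both sides: the sum up to n + 1 is large enough for the descent, and the sum
  -- up to n is small enough for `factorial_le_prod_weight` with c = eL.
  set n := Nat.find hex with hn
  have hn1 : e * L ≤ weightSum μ 1 (n + 1) := Nat.find_spec hex
  have hnn₀ : n ≤ n₀ := Nat.find_min' hex hsum
  have hn2 : weightSum μ 1 n < e * L := by
    rcases Nat.eq_zero_or_pos n with h | h
    · rw [h]; simp only [weightSum]; simp; positivity
    · by_contra! hc
      have := Nat.find_min hex (show n - 1 < Nat.find hex by omega)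
      rw [Nat.sub_add_cancel h] at this
      exact this hc
  -- Then n h < m, so T contains n + 1 points with gaps at least h.
  set h := m / (n + 1) with hh
  have hh0 : 0 < h := by positivity
  obtain ⟨z, hzT, hzgap⟩ := exists_separated_points hh0 n T (bddBelow_Icc.mono hTL)
    ((ENNReal.ofReal_lt_ofReal_iff hm).2 (by
      rw [hh, mul_div_assoc', div_lt_iff₀ (by positivity)]; nlinarith) |>.trans_le hmT)
  set P := Lagrange.interpolate (Finset.range (n + 1)) z (fun i => G 0 (z i)) with hP
  have hzmono : StrictMonoOn z (Set.Iic n) := by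
    intro i hi j hj hij
    have h1 := add_mul_le_of_gaps hzgap j hij.le hj
    have h2 : (0 : ℝ) < (j - i : ℝ) * h :=
      mul_pos (sub_pos.2 (by exact_mod_cast hij)) hh0
    linarith
  have hinj : Set.InjOn z (Finset.range (n + 1)) := fun i hi j hj hij =>
    hzmono.injOn (by simpa [Nat.lt_succ_iff] using hi) (by simpa [Nat.lt_succ_iff] using hj) hij
  -- The Lagrange bound with σ = eL, the radius that matches l! ≤ (eL)^l μ_1⋯μ_l.
  set κ := ε * ((L + e * L) / h) ^ n * (2 ^ n / (n ! : ℝ)) with hκ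
  have hcoef : ∀ x ∈ Icc 0 L, ∀ j, |(Polynomial.taylor x P).coeff j| * (e * L) ^ j ≤ κ := by
    intro x hx j
    refine abs_coeff_taylor_interpolate_le hh0 hzgap hL.le (by positivity) (fun i hi => ?_)
      (fun i hi => hT _ (hzT i hi)) j
    have hzi := hTL (hzT i hi)
    exact abs_sub_le_iff.2 ⟨by linarith [hx.2, hzi.1], by linarith [hx.1, hzi.2]⟩
  -- From (n+1)^n/n! ≤ e^{n+1} one gets κ ≤ ε e b^n. Moreover b ≥ 20e, and ε b^{n+1} < A by `hcon`
  -- because n + 1 ≤ 2n₀. The 20 is a margin for the final comparison.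
  have hκA : κ ≤ A / 20 := by
    set b := 2 * Real.exp 4 * (L / m) with hb
    have hb20 : 20 * e ≤ b := by
      have : 20 * e ≤ 2 * e ^ 4 := by nlinarith [pow_pos (by linarith : 0 < e) 3, sq_nonneg e]
      calc 20 * e ≤ 2 * Real.exp 4 := by rw [he4]; exact this
        _ ≤ b := le_mul_of_one_le_right (by positivity) hmL
    have hb1 : 1 ≤ b := by linarith
    have h1 : κ ≤ ε * e * b ^ n := by
      have h2 : ((n : ℝ) + 1) ^ n / (n ! : ℝ) ≤ e ^ (n + 1) := by
        have := Real.pow_div_factorial_le_exp ((n : ℝ) + 1) (by positivity) n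
        rwa [show ((n : ℝ) + 1) = ((n + 1 : ℕ) : ℝ) * 1 by push_cast; ring, Real.exp_nat_mul,
          mul_one, Nat.cast_succ] at this
      have h3 : κ = ε * (2 * (1 + e) * (L / m)) ^ n * (((n : ℝ) + 1) ^ n / (n ! : ℝ)) := by
        rw [hκ, hh, show (L + e * L) / (m / ((n : ℝ) + 1)) = (1 + e) * (L / m) * ((n : ℝ) + 1) by
          field_simp, mul_pow _ ((n : ℝ) + 1), show 2 * (1 + e) * (L / m) = (1 + e) * (L / m) * 2 by
          ring, mul_pow _ (2 : ℝ)]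
        ring
      rw [h3]
      calc _ ≤ ε * (2 * (1 + e) * (L / m)) ^ n * e ^ (n + 1) := by gcongr
        _ = ε * e * (2 * (1 + e) * (L / m) * e) ^ n := by rw [mul_pow _ e, pow_succ]; ring
        _ ≤ ε * e * b ^ n := by
          have : 2 * (1 + e) * (L / m) * e ≤ b := by
            rw [hb, he4]
            have : (1 + e) * e ≤ e ^ 4 := by
              nlinarith [pow_pos (by linarith : 0 < e) 3, sq_nonneg e]
            calc _ = 2 * ((1 + e) * e) * (L / m) := by ring
              _ ≤ _ := by gcongr
          gcongr
    have h2 : ε * b ^ (n + 1) < A := by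
      refine lt_of_le_of_lt ?_ hcon
      rw [mul_comm]
      exact mul_le_mul_of_nonneg_right (pow_le_pow_right₀ hb1 (by omega)) hε
    have h3 : ε * b ^ n * (20 * e) ≤ ε * b ^ (n + 1) := by
      have h4 : 0 ≤ ε * b ^ n := by positivity
      have h5 := mul_le_mul_of_nonneg_left hb20 h4
      rw [pow_succ]
      linarith
    linarith
  have hκ0 : 0 ≤ κ := by positivity
  have hPd : ∀ l ≤ n + 1, ∀ x ∈ Icc 0 L,
      |(Polynomial.derivative^[l] P).eval x| ≤ κ * ∏ i ∈ Finset.Icc 1 l, μ i := by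
    intro l hl x hx
    have hM := prod_Icc_weight_pos hμ l
    rcases Nat.lt_or_ge n l with h1 | h1
    · have hdeg : P.natDegree < l := by
        have h2 := Lagrange.degree_interpolate_lt (fun i => G 0 (z i)) hinj
        rw [Finset.card_range, ← hP] at h2
        rcases eq_or_ne P 0 with h3 | h3
        · rw [h3, Polynomial.natDegree_zero]; omega
        · exact ((Polynomial.natDegree_lt_iff_degree_lt h3).2 h2).trans_le (by omega)
      rw [Polynomial.iterate_derivative_eq_zero hdeg, Polynomial.eval_zero, abs_zero]
      positivity
    · rw [← Polynomial.factorial_smul_hasseDeriv, LinearMap.smul_apply, Polynomial.eval_smul,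
        ← Polynomial.taylor_coeff, nsmul_eq_mul, abs_mul, Nat.abs_cast]
      have h2 := factorial_le_prod_weight hμ hn2 h1
      calc _ ≤ ((e * L) ^ l * ∏ i ∈ Finset.Icc 1 l, μ i) * |(Polynomial.taylor x P).coeff l| := by
            gcongr
        _ = (|(Polynomial.taylor x P).coeff l| * (e * L) ^ l) * ∏ i ∈ Finset.Icc 1 l, μ i := by ring
        _ ≤ _ := by gcongr; exact hcoef x hx l
  set H : ℕ → ℝ → ℝ := fun l x => G l x - (Polynomial.derivative^[l] P).eval x with hH
  have hHder : ∀ l < n + 1, ∀ x ∈ Icc 0 L, HasDerivAt (H l) (H (l + 1) x) x := by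
    intro l hl x hx
    simp only [hH]
    rw [Function.iterate_succ_apply']
    exact (hder l (by omega) x hx).sub (Polynomial.hasDerivAt _ x)
  -- Derivatives of G up to order n + 1 are needed; n + 1 ≤ 2n₀ since n ≤ n₀ and n₀ ≥ 1.
  have hHbd : ∀ l ≤ n + 1, ∀ x ∈ Icc 0 L, |H l x| ≤ (A + κ) * ∏ i ∈ Finset.Icc 1 l, μ i := by
    intro l hl x hx
    rw [add_mul]
    exact (abs_sub _ _).trans (add_le_add (hbd l (by omega) x hx) (hPd l hl x hx))
  obtain ⟨y, -, hymono, hyI, hyz⟩ := exists_zeros_of_derivs (n + 1) H z hHder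
    (fun i hi => hzmono (by simp; omega) (by simp; omega) (Nat.lt_succ_self i))
    (fun i hi => hTL (hzT i (by omega)))
    (fun i hi => by
      simp only [hH, Function.iterate_zero, id]
      rw [hP, Lagrange.eval_interpolate_at_node _ hinj (Finset.mem_range.2 hi), sub_self])
  have hfin := bang_descent hμ (by omega) hHder hHbd hymono hyI hyz hn1
  have hP0 := hPd 0 (by omega) 0 ⟨le_rfl, hL.le⟩
  have hH0 : A - κ ≤ |H 0 0| := by
    have := abs_sub_abs_le_abs_sub (G 0 0) ((Polynomial.derivative^[0] P).eval 0)
    rw [h0] at this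
    simp only [Finset.Icc_eq_empty_of_lt zero_lt_one, Finset.prod_empty, mul_one] at hP0
    simp only [hH]
    linarith
  -- The descent gives e(A − κ) ≤ 2(A + κ), but κ ≤ A/20 and e > 2.7 make the left side exceed 2.56
  -- A and the right side at most 2.1 A.
  nlinarith

/-! ### Polar coordinates and the choice of a segment -/

open Measure in
/-- The volume of a measurable set in polar coordinates. -/
theorem volume_eq_lintegral_toSphere {d : ℕ} (hd : 1 ≤ d)
    {S : Set (EuclideanSpace ℝ (Fin d))} (hS : MeasurableSet S) :
    volume S = ∫⁻ θ, (∫⁻ r in {r : ℝ | 0 < r ∧ r • (θ : EuclideanSpace ℝ (Fin d)) ∈ S},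
      ENNReal.ofReal (r ^ (d - 1))) ∂(volume : Measure (EuclideanSpace ℝ (Fin d))).toSphere := by
  have : Nonempty (Fin d) := ⟨⟨0, hd⟩⟩
  have hmp := measurePreserving_homeomorphUnitSphereProd
    (volume : Measure (EuclideanSpace ℝ (Fin d)))
  rw [finrank_euclideanSpace_fin] at hmp
  set B : Set (Metric.sphere (0 : EuclideanSpace ℝ (Fin d)) 1 × Ioi (0 : ℝ)) :=
    {p | (p.2 : ℝ) • (p.1 : EuclideanSpace ℝ (Fin d)) ∈ S} with hB
  have hBm : MeasurableSet B := by
    refine hS.preimage ?_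
    fun_prop
  have hpre : homeomorphUnitSphereProd (EuclideanSpace ℝ (Fin d)) ⁻¹' B =
      (Subtype.val : ({0}ᶜ : Set (EuclideanSpace ℝ (Fin d))) → _) ⁻¹' S := by
    ext x
    have hx : ‖(x : EuclideanSpace ℝ (Fin d))‖ ≠ 0 := norm_ne_zero_iff.2 x.2
    simp [hB, smul_smul, hx]
  have h1 : volume S = (Measure.comap (Subtype.val : ({0}ᶜ : Set (EuclideanSpace ℝ (Fin d))) → _)
      volume) (Subtype.val ⁻¹' S) := by
    rw [comap_subtype_coe_apply (measurableSet_singleton _).compl, Subtype.image_preimage_coe,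
      inter_comm, ← sdiff_eq, measure_sdiff_null (measure_singleton _)]
  rw [h1, ← hpre, hmp.measure_preimage hBm.nullMeasurableSet, prod_apply hBm]
  refine lintegral_congr fun θ => ?_
  rw [volumeIoiPow, withDensity_apply _ (hBm.preimage measurable_prodMk_left),
    setLIntegral_subtype measurableSet_Ioi _ fun a : ℝ => ENNReal.ofReal (a ^ (d - 1))]
  congr 2
  ext r
  simp [hB, and_comm]

/-- Through a point of a convex body there is a segment meeting a given subset in a set of
comparable relative measure. -/
theorem exists_segment_of_volume_pos {d : ℕ} (hd : 1 ≤ d)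
    {K F : Set (EuclideanSpace ℝ (Fin d))} (hK : IsCompact K) (hconv : Convex ℝ K)
    {x₀ : EuclideanSpace ℝ (Fin d)} (hx₀ : x₀ ∈ K) (hF : MeasurableSet F) (hFK : F ⊆ K)
    (hFpos : 0 < volume F) :
    ∃ θ : EuclideanSpace ℝ (Fin d), ‖θ‖ = 1 ∧ ∃ L > 0, (∀ t ∈ Icc 0 L, x₀ + t • θ ∈ K) ∧
      ∃ T ⊆ Icc 0 L, (∀ t ∈ T, x₀ + t • θ ∈ F) ∧
        ENNReal.ofReal (L * volume.real F / (2 * d * volume.real K)) ≤ volume T := by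
  by_contra! hcon
  have hKfin : volume K ≠ ∞ := hK.measure_ne_top
  have hFfin : volume F ≠ ∞ := ((measure_mono hFK).trans_lt hK.measure_lt_top).ne
  have hFr : 0 < volume.real F := ENNReal.toReal_pos hFpos.ne' hFfin
  have hKr : 0 < volume.real K := hFr.trans_le (measureReal_mono hFK hKfin)
  have hd0 : (0 : ℝ) < d := by exact_mod_cast hd
  -- The factor 1/2 lets a non-strict inequality on every ray integrate to the contradiction |F| ≤
  -- |F|/2.
  set c := volume.real F / (2 * volume.real K) with hc
  have hc0 : 0 < c := by positivity
  have hvol : ∀ S : Set (EuclideanSpace ℝ (Fin d)), volume ((fun x => x₀ + x) ⁻¹' S) = volume S :=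
    fun S => measure_preimage_add _ _ _
  have hmeas : Measurable (fun x : EuclideanSpace ℝ (Fin d) => x₀ + x) := measurable_const_add x₀
  have hlt : volume F ≤ ENNReal.ofReal c * volume K := by
    rw [← hvol F, ← hvol K, volume_eq_lintegral_toSphere hd (hmeas hF),
      volume_eq_lintegral_toSphere hd (hmeas hK.measurableSet),
      ← lintegral_const_mul' _ _ ENNReal.ofReal_ne_top]
    refine lintegral_mono fun θ => ?_
    have hθ : ‖(θ : EuclideanSpace ℝ (Fin d))‖ = 1 := by simp
    set v : EuclideanSpace ℝ (Fin d) := (θ : EuclideanSpace ℝ (Fin d))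
    set R : Set ℝ := {r | 0 ≤ r ∧ x₀ + r • v ∈ K} with hR
    have hRc : IsClosed R := by
      have h1 : IsClosed ((fun r : ℝ => x₀ + r • v) ⁻¹' K) :=
        hK.isClosed.preimage (by fun_prop)
      exact isClosed_Ici.inter h1
    have hRb : BddAbove R := by
      obtain ⟨C, hC⟩ := hK.isBounded.exists_norm_le
      refine ⟨C + ‖x₀‖, fun r hr => ?_⟩
      have h1 : ‖r • v‖ = r := by rw [norm_smul, hθ, mul_one, Real.norm_of_nonneg hr.1]
      have h2 := norm_sub_le (x₀ + r • v) x₀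
      rw [add_sub_cancel_left, h1] at h2
      linarith [hC _ hr.2]
    have h0R : (0 : ℝ) ∈ R := ⟨le_rfl, by simpa using hx₀⟩
    set ρ := sSup R
    have hρR : ρ ∈ R := hRc.csSup_mem ⟨0, h0R⟩ hRb
    have hseg : ∀ t ∈ Icc 0 ρ, x₀ + t • v ∈ K := by
      intro t ht
      rcases hρR.1.eq_or_lt with h | h
      · have : t = 0 := le_antisymm (ht.2.trans h.symm.le) ht.1
        simpa [this] using hx₀
      · have := hconv.add_smul_sub_mem hx₀ hρR.2 (t := t / ρ)
          ⟨div_nonneg ht.1 h.le, (div_le_one h).2 ht.2⟩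
        rwa [add_sub_cancel_left, smul_smul, div_mul_cancel₀ _ h.ne'] at this
    set T : Set ℝ := {r | 0 < r ∧ r • v ∈ (fun x => x₀ + x) ⁻¹' F} with hT
    have hTρ : T ⊆ Ioc 0 ρ := fun r hr => ⟨hr.1, le_csSup hRb ⟨hr.1.le, hFK hr.2⟩⟩
    have hTm : MeasurableSet T :=
      measurableSet_Ioi.inter (hF.preimage (by fun_prop : Measurable fun r : ℝ => x₀ + r • v))
    rcases hρR.1.eq_or_lt with hρ | hρ
    · have : T = ∅ := by
        rw [eq_empty_iff_forall_notMem]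
        intro r hr
        have := hTρ hr
        rw [← hρ] at this
        simp at this
      simp [this]
    · have hTv := hcon v hθ ρ hρ hseg T (hTρ.trans Ioc_subset_Icc_self) fun t ht => ht.2
      have hin : ∫⁻ r in Ioc 0 ρ, ENNReal.ofReal (r ^ (d - 1)) = ENNReal.ofReal (ρ ^ d / d) := by
        rw [← ofReal_integral_eq_lintegral_ofReal (intervalIntegral.intervalIntegrable_pow _).1,
          ← intervalIntegral.integral_of_le hρ.le]
        · simp only [integral_pow]
          rw [Nat.sub_add_cancel hd, zero_pow (by omega), sub_zero, Nat.cast_sub hd]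
          simp
        · filter_upwards [ae_restrict_mem measurableSet_Ioc] with y hy
          exact pow_nonneg hy.1.le _
      -- On T the density r^{d-1} is at most ρ^{d-1}, while the ray inside K carries ρ^d/d. This
      -- comparison is the source of the factor d.
      calc ∫⁻ r in T, ENNReal.ofReal (r ^ (d - 1))
          ≤ ∫⁻ _ in T, ENNReal.ofReal (ρ ^ (d - 1)) :=
            setLIntegral_mono measurable_const fun r hr => by
              have := hTρ hr
              gcongr
              · exact this.1.le
              · exact this.2
        _ = ENNReal.ofReal (ρ ^ (d - 1)) * volume T := setLIntegral_const _ _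
        _ ≤ ENNReal.ofReal (ρ ^ (d - 1)) *
              ENNReal.ofReal (ρ * volume.real F / (2 * d * volume.real K)) := by gcongr
        _ = ENNReal.ofReal c * ENNReal.ofReal (ρ ^ d / d) := by
            rw [← ENNReal.ofReal_mul (by positivity), ← ENNReal.ofReal_mul hc0.le]
            congr 1
            rw [hc, show ρ ^ d = ρ ^ (d - 1) * ρ by rw [← pow_succ, Nat.sub_add_cancel hd]]
            field_simp
        _ ≤ _ := by
            rw [← hin]
            refine mul_le_mul_right ?_ _
            have hsub : Ioc 0 ρ ⊆ {r : ℝ | 0 < r ∧ r • v ∈ (fun x => x₀ + x) ⁻¹' K} :=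
              fun r hr => ⟨hr.1, hseg r ⟨hr.1.le, hr.2⟩⟩
            exact lintegral_mono_set hsub
  have h2 := ENNReal.toReal_mono (ENNReal.mul_ne_top ENNReal.ofReal_ne_top hKfin) hlt
  rw [ENNReal.toReal_mul, ENNReal.toReal_ofReal hc0.le] at h2
  change volume.real F ≤ c * volume.real K at h2
  have : c * volume.real K = volume.real F / 2 := by rw [hc]; field_simp
  linarith

/-! ### Iterated partial derivatives -/

section PartialDerivatives

variable {d : ℕ} {U : Set (EuclideanSpace ℝ (Fin d))} {g g' f : EuclideanSpace ℝ (Fin d) → ℝ}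

theorem ContDiffOn.partialDeriv (hU : IsOpen U) {m : ℕ} (hg : ContDiffOn ℝ (m + 1 : ℕ) g U)
    (i : Fin d) : ContDiffOn ℝ m (partialDeriv i g) U :=
  (hg.fderiv_of_isOpen hU (m := m) (by norm_cast)).clm_apply contDiffOn_const

theorem partialDeriv_congr (hU : IsOpen U) (h : EqOn g g' U) (i : Fin d) :
    EqOn (partialDeriv i g) (partialDeriv i g') U := fun x hx => by
  simp only [partialDeriv]
  rw [(h.eventuallyEq_of_mem (hU.mem_nhds hx)).fderiv_eq]

theorem iterate_partialDeriv_congr (hU : IsOpen U) (h : EqOn g g' U) (i : Fin d) (m : ℕ) :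
    EqOn ((partialDeriv i)^[m] g) ((partialDeriv i)^[m] g') U := by
  induction m with
  | zero => exact h
  | succ m ih =>
    rw [Function.iterate_succ_apply', Function.iterate_succ_apply']
    exact partialDeriv_congr hU ih i

theorem ContDiffOn.iterate_partialDeriv (hU : IsOpen U) (i : Fin d) {k m : ℕ}
    (hg : ContDiffOn ℝ (m + k : ℕ) g U) : ContDiffOn ℝ m ((_root_.partialDeriv i)^[k] g) U := by
  induction k generalizing m with
  | zero => exact hg
  | succ k ih =>
    rw [Function.iterate_succ_apply']
    exact ContDiffOn.partialDeriv hU (ih (m := m + 1) (by convert hg using 2; omega)) i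

theorem partialDeriv_comm (hU : IsOpen U) (hg : ContDiffOn ℝ (2 : ℕ) g U) (i j : Fin d) :
    EqOn (partialDeriv i (partialDeriv j g)) (partialDeriv j (partialDeriv i g)) U := by
  intro x hx
  have hd : DifferentiableAt ℝ (fderiv ℝ g) x :=
    ((hg.fderiv_of_isOpen hU (m := 1) (by norm_num)).differentiableOn (by simp)).differentiableAt
      (hU.mem_nhds hx)
  have hs : IsSymmSndFDerivAt ℝ g x :=
    (hg.contDiffAt (hU.mem_nhds hx)).isSymmSndFDerivAt (by simp)
  have key : ∀ a b : Fin d, partialDeriv a (partialDeriv b g) x =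
      fderiv ℝ (fderiv ℝ g) x (EuclideanSpace.single a 1) (EuclideanSpace.single b 1) := by
    intro a b
    have : HasFDerivAt (partialDeriv b g) _ x :=
      hd.hasFDerivAt.clm_apply (hasFDerivAt_const (EuclideanSpace.single b (1 : ℝ)) x)
    rw [partialDeriv, this.fderiv]
    simp
  rw [key, key]
  exact hs.eq _ _

theorem partialDeriv_iterate_comm (hU : IsOpen U) (i a : Fin d) {m : ℕ}
    (hg : ContDiffOn ℝ (m + 1 : ℕ) g U) :
    EqOn (partialDeriv i ((partialDeriv a)^[m] g)) ((partialDeriv a)^[m] (partialDeriv i g)) U := by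
  induction m with
  | zero => exact fun _ _ => rfl
  | succ m ih =>
    rw [Function.iterate_succ_apply', Function.iterate_succ_apply']
    have h2 : ContDiffOn ℝ (2 : ℕ) ((partialDeriv a)^[m] g) U :=
      ContDiffOn.iterate_partialDeriv hU a (by convert hg using 2; omega)
    exact (partialDeriv_comm hU h2 i a).trans (partialDeriv_congr hU
      (ih (hg.of_le (by norm_cast; omega))) a)

theorem ContDiffOn.foldr_partialDeriv (hU : IsOpen U) (α : Fin d → ℕ) (l : List (Fin d)) {m : ℕ}
    (hf : ContDiffOn ℝ (m + (l.map α).sum : ℕ) f U) :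
    ContDiffOn ℝ m (l.foldr (fun i g => (_root_.partialDeriv i)^[α i] g) f) U := by
  induction l generalizing m with
  | nil => simpa using hf
  | cons a l ih =>
    rw [List.foldr_cons]
    refine ContDiffOn.iterate_partialDeriv hU a (ih ?_)
    convert hf using 2
    rw [List.map_cons, List.sum_cons]
    omega

/-- The partial derivatives are taken in a fixed order, so an extra ∂_i has to be moved inwards past
the outer ones by symmetry of second derivatives. -/
theorem partialDeriv_foldr (hU : IsOpen U) (α : Fin d → ℕ) (i : Fin d) (l : List (Fin d))
    (hl : l.Nodup) (hi : i ∈ l) (hf : ContDiffOn ℝ ((l.map α).sum + 1 : ℕ) f U) :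
    EqOn (partialDeriv i (l.foldr (fun i g => (partialDeriv i)^[α i] g) f))
      (l.foldr (fun k g => (partialDeriv k)^[(α + Pi.single i 1 : Fin d → ℕ) k] g) f) U := by
  induction l with
  | nil => simp at hi
  | cons a l ih =>
    rw [List.foldr_cons, List.foldr_cons]
    obtain ⟨hal, hl'⟩ := List.nodup_cons.1 hl
    rw [List.map_cons, List.sum_cons] at hf
    by_cases hia : i = a
    · subst hia
      have h1 : l.foldr (fun k g => (partialDeriv k)^[(α + Pi.single i 1 : Fin d → ℕ) k] g) f =
          l.foldr (fun k g => (partialDeriv k)^[α k] g) f := by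
        refine List.foldr_ext _ _ _ fun k hk _ => ?_
        have : k ≠ i := fun h => hal (h ▸ hk)
        simp [this]
      rw [h1]
      simp only [Pi.add_apply, Pi.single_eq_same, Function.iterate_succ_apply']
      exact fun _ _ => rfl
    · have hil : i ∈ l := (List.mem_cons.1 hi).resolve_left hia
      have h1 : (α + Pi.single i 1 : Fin d → ℕ) a = α a := by
        simp [Ne.symm hia]
      rw [h1]
      refine (partialDeriv_iterate_comm hU i a (ContDiffOn.foldr_partialDeriv hU α l
        (by convert hf using 2; omega))).trans ?_
      exact iterate_partialDeriv_congr hU (ih hl' hil (hf.of_le (by norm_cast; omega))) a _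

theorem sum_map_finRange (α : Fin d → ℕ) : ((List.finRange d).map α).sum = ∑ i, α i := by
  rw [← List.ofFn_eq_map, List.sum_ofFn]

theorem ContDiffOn.multiDeriv (hU : IsOpen U) (α : Fin d → ℕ) {m : ℕ}
    (hf : ContDiffOn ℝ (m + ∑ i, α i : ℕ) f U) : ContDiffOn ℝ m (multiDeriv α f) U :=
  ContDiffOn.foldr_partialDeriv hU α _ (by rwa [sum_map_finRange])

theorem partialDeriv_multiDeriv (hU : IsOpen U) (α : Fin d → ℕ) (i : Fin d)
    (hf : ContDiffOn ℝ (∑ i, α i + 1 : ℕ) f U) :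
    EqOn (partialDeriv i (multiDeriv α f)) (multiDeriv (α + Pi.single i 1) f) U :=
  partialDeriv_foldr hU α i _ (List.nodup_finRange d) (List.mem_finRange i)
    (by rwa [sum_map_finRange])

theorem fderiv_apply_eq_sum_partialDeriv (x v : EuclideanSpace ℝ (Fin d)) :
    fderiv ℝ g x v = ∑ i, v i * partialDeriv i g x := by
  have hv : v = ∑ i, v i • EuclideanSpace.single i (1 : ℝ) := by
    ext j
    simp [Pi.single_apply]
  conv_lhs => rw [hv]
  rw [map_sum]
  simp [partialDeriv]

theorem multiDeriv_hasDerivAt_line (hU : IsOpen U) (α : Fin d → ℕ)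
    (hf : ContDiffOn ℝ (∑ i, α i + 1 : ℕ) f U) {x₀ v : EuclideanSpace ℝ (Fin d)} {t : ℝ}
    (ht : x₀ + t • v ∈ U) :
    HasDerivAt (fun t : ℝ => multiDeriv α f (x₀ + t • v))
      (∑ i, v i * multiDeriv (α + Pi.single i 1) f (x₀ + t • v)) t := by
  have hd : DifferentiableAt ℝ (multiDeriv α f) (x₀ + t • v) :=
    ((ContDiffOn.multiDeriv hU α (m := 1) (by rwa [add_comm])).differentiableOn
      (by simp)).differentiableAt (hU.mem_nhds ht)
  have hline : HasDerivAt (fun t : ℝ => x₀ + t • v) v t := by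
    simpa using ((hasDerivAt_id t).smul_const v).const_add x₀
  have := hd.hasFDerivAt.comp_hasDerivAt t hline
  rw [fderiv_apply_eq_sum_partialDeriv] at this
  refine this.congr_deriv ?_
  exact Finset.sum_congr rfl fun i _ => by rw [partialDeriv_multiDeriv hU α i hf ht]

end PartialDerivatives

/-! ### Directional derivatives through polynomial symbols -/

section DirectionalDerivatives

variable {d : ℕ}

/-- The linear functional `X^α ↦ f^{(α)}(x)`. -/
noncomputable def derivFunctional (f : EuclideanSpace ℝ (Fin d) → ℝ)
    (x : EuclideanSpace ℝ (Fin d)) : MvPolynomial (Fin d) ℝ →ₗ[ℝ] ℝ :=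
  (MvPolynomial.basisMonomials (Fin d) ℝ).constr ℝ fun s => multiDeriv (⇑s) f x

theorem derivFunctional_monomial (f : EuclideanSpace ℝ (Fin d) → ℝ)
    (x : EuclideanSpace ℝ (Fin d)) (s : Fin d →₀ ℕ) (c : ℝ) :
    derivFunctional f x (MvPolynomial.monomial s c) = c * multiDeriv (⇑s) f x := by
  have h : MvPolynomial.monomial s c = c • MvPolynomial.basisMonomials (Fin d) ℝ s := by
    rw [MvPolynomial.coe_basisMonomials, MvPolynomial.smul_monomial, smul_eq_mul, mul_one]
  rw [h, map_smul, derivFunctional, Module.Basis.constr_basis, smul_eq_mul]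

/-- The coefficient of `f^{(α)}` in the `|α|`-th derivative of `f` in direction `v`. -/
noncomputable def directionCoeff (v : EuclideanSpace ℝ (Fin d)) (α : Fin d → ℕ) : ℝ :=
  (Nat.multinomial Finset.univ α : ℝ) * ∏ i, v i ^ α i

/-- The `j`-th derivative of `f` at `x` in direction `v`. -/
noncomputable def directionDeriv (f : EuclideanSpace ℝ (Fin d) → ℝ)
    (v : EuclideanSpace ℝ (Fin d)) (j : ℕ) (x : EuclideanSpace ℝ (Fin d)) : ℝ :=
  ∑ α ∈ Finset.piAntidiag (Finset.univ : Finset (Fin d)) j,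
    directionCoeff v α * multiDeriv α f x

theorem linearForm_pow (v : EuclideanSpace ℝ (Fin d)) (j : ℕ) :
    (∑ i, MvPolynomial.monomial (Finsupp.single i 1) (v i)) ^ j =
      ∑ α ∈ Finset.piAntidiag (Finset.univ : Finset (Fin d)) j,
        MvPolynomial.monomial (Finsupp.equivFunOnFinite.symm α) (directionCoeff v α) := by
  rw [Finset.sum_pow_eq_sum_piAntidiag]
  refine Finset.sum_congr rfl fun α _ => ?_
  simp only [MvPolynomial.monomial_eq, directionCoeff]
  rw [Finsupp.prod_fintype _ _ (by simp)]
  simp [mul_pow, Finset.prod_mul_distrib, mul_assoc]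

theorem directionDeriv_eq (f : EuclideanSpace ℝ (Fin d) → ℝ)
    (v : EuclideanSpace ℝ (Fin d)) (j : ℕ) (x : EuclideanSpace ℝ (Fin d)) :
    directionDeriv f v j x =
      derivFunctional f x ((∑ i, MvPolynomial.monomial (Finsupp.single i 1) (v i)) ^ j) := by
  rw [linearForm_pow, map_sum]
  exact Finset.sum_congr rfl fun α _ => by rw [derivFunctional_monomial]; rfl

theorem directionDeriv_zero (f : EuclideanSpace ℝ (Fin d) → ℝ)
    (v : EuclideanSpace ℝ (Fin d)) (x : EuclideanSpace ℝ (Fin d)) :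
    directionDeriv f v 0 x = f x := by
  rw [directionDeriv_eq, pow_zero, ← MvPolynomial.C_1, ← MvPolynomial.monomial_zero',
    derivFunctional_monomial, one_mul, multiDeriv]
  have : ∀ l : List (Fin d), l.foldr (fun i g => (partialDeriv i)^[(0 : Fin d →₀ ℕ) i] g) f = f := by
    intro l
    induction l with
    | nil => rfl
    | cons a l ih => rw [List.foldr_cons, ih]; rfl
  rw [this]

/-- Order j corresponds to the symbol (∑ v_i X_i)^j, and differentiating along v multiplies it by ∑
v_i X_i. The recursion for multinomial coefficients thereby reduces to `pow_succ`. -/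
theorem hasDerivAt_directionDeriv {f : EuclideanSpace ℝ (Fin d) → ℝ}
    {U : Set (EuclideanSpace ℝ (Fin d))} (hU : IsOpen U) {n j : ℕ} (hf : ContDiffOn ℝ n f U)
    (hj : j < n) {x₀ v : EuclideanSpace ℝ (Fin d)} {t : ℝ} (ht : x₀ + t • v ∈ U) :
    HasDerivAt (fun t : ℝ => directionDeriv f v j (x₀ + t • v))
      (directionDeriv f v (j + 1) (x₀ + t • v)) t := by
  have h := HasDerivAt.fun_sum (u := Finset.piAntidiag (Finset.univ : Finset (Fin d)) j)
    fun α hα => (multiDeriv_hasDerivAt_line hU α (f := f) (x₀ := x₀) (v := v) (t := t)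
      (hf.of_le (by
        have : ∑ i, α i = j := (Finset.mem_piAntidiag.1 hα).1
        norm_cast
        omega)) ht).const_mul (directionCoeff v α)
  refine h.congr_deriv ?_
  symm
  rw [directionDeriv_eq, pow_succ, linearForm_pow, Finset.sum_mul, map_sum]
  refine Finset.sum_congr rfl fun α _ => ?_
  rw [Finset.mul_sum, map_sum, Finset.mul_sum]
  refine Finset.sum_congr rfl fun i _ => ?_
  rw [MvPolynomial.monomial_mul, derivFunctional_monomial, mul_assoc]
  congr 3
  ext k
  simp [Finsupp.single_apply, Pi.single_apply, eq_comm]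

theorem abs_le_supNorm {K : Set (EuclideanSpace ℝ (Fin d))} (hK : IsCompact K)
    {g : EuclideanSpace ℝ (Fin d) → ℝ} (hg : ContinuousOn g K) {x : EuclideanSpace ℝ (Fin d)}
    (hx : x ∈ K) : |g x| ≤ supNorm K g := by
  have hb : BddAbove (range fun x : K => |g x|) := by
    obtain ⟨C, hC⟩ := hK.exists_bound_of_continuousOn hg
    exact ⟨C, by rintro _ ⟨y, rfl⟩; exact hC y y.2⟩
  exact le_ciSup hb (⟨x, hx⟩ : K)

/-- A unit vector has |v_i| ≤ 1, so the coefficient of f^{(α)} is at most j!/α!, the weight used in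
`derivNorm`. -/
theorem abs_directionDeriv_le {K : Set (EuclideanSpace ℝ (Fin d))} (hK : IsCompact K)
    {f : EuclideanSpace ℝ (Fin d) → ℝ} {U : Set (EuclideanSpace ℝ (Fin d))} (hU : IsOpen U)
    (hKU : K ⊆ U) {n j : ℕ} (hf : ContDiffOn ℝ n f U) (hj : j ≤ n)
    {x v : EuclideanSpace ℝ (Fin d)} (hx : x ∈ K) (hv : ‖v‖ = 1) :
    |directionDeriv f v j x| ≤ derivNorm j K f := by
  refine (Finset.abs_sum_le_sum_abs _ _).trans (Finset.sum_le_sum fun α hα => ?_)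
  have hsum : ∑ i, α i = j := (Finset.mem_piAntidiag.1 hα).1
  have hcont : ContinuousOn (multiDeriv α f) K :=
    ((ContDiffOn.multiDeriv hU α (m := 0) (hf.of_le (by norm_cast; omega))).continuousOn).mono hKU
  have hmult : (Nat.multinomial Finset.univ α : ℝ) = (j ! : ℝ) / ∏ i, ((α i)! : ℝ) := by
    have h := Nat.multinomial_spec (Finset.univ : Finset (Fin d)) α
    rw [hsum] at h
    rw [eq_div_iff (Finset.prod_pos fun i _ => by positivity).ne', ← h]
    push_cast
    ring
  have hcoef : |directionCoeff v α| ≤ (j ! : ℝ) / ∏ i, ((α i)! : ℝ) := by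
    rw [directionCoeff, abs_mul, Nat.abs_cast, hmult, Finset.abs_prod]
    refine mul_le_of_le_one_right (by positivity) (Finset.prod_le_one (fun _ _ => abs_nonneg _)
      fun i _ => ?_)
    rw [abs_pow]
    refine pow_le_one₀ (abs_nonneg _) ?_
    rw [← hv]
    exact PiLp.norm_apply_le v i
  rw [abs_mul]
  exact mul_le_mul hcoef (abs_le_supNorm hK hcont hx) (abs_nonneg _) ((abs_nonneg _).trans hcoef)

end DirectionalDerivatives

/-! ### The constant C_N -/

theorem IsInterpolant.sideDeriv_nonneg {ν : ℝ → ℝ} {μ : ℕ → ℝ} (hν : IsInterpolant ν μ) {s : ℝ}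
    (hs : 1 ≤ s) : 0 ≤ sideDeriv ν s := by
  unfold sideDeriv
  split_ifs with h
  · obtain rfl : s = 1 := le_antisymm h hs
    exact hν.mono.derivWithin_nonneg
  · have h1 : Iic s =ᶠ[𝓝 s] Icc 1 s := by
      filter_upwards [Ioi_mem_nhds (not_le.1 h)] with x hx
      exact propext ⟨fun hxs => ⟨(mem_Ioi.1 hx).le, hxs⟩, fun hxs => hxs.2⟩
    rw [derivWithin_congr_set h1]
    exact (hν.mono.mono Icc_subset_Ici_self).derivWithin_nonneg

theorem IsInterpolant.growthExponent_nonneg {ν : ℝ → ℝ} {μ : ℕ → ℝ} (hν : IsInterpolant ν μ)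
    (n : ℕ) : 0 ≤ growthExponent ν n := by
  -- A real `sSup` of a set unbounded above is 0, so no boundedness has to be checked.
  refine Real.sSup_nonneg ?_
  rintro _ ⟨s, hs, rfl⟩
  have := hν.sideDeriv_nonneg hs.1
  have := hν.pos s hs.1
  have : 0 ≤ s := zero_le_one.trans hs.1
  positivity

/-- The argument produces the constant 4e^4; γ_ν ≥ 0 lets C_N replace it. -/
theorem IsInterpolant.le_remezConst {ν : ℝ → ℝ} {μ : ℕ → ℝ} (hν : IsInterpolant ν μ)
    (N : ℕ) : 4 * Real.exp 4 ≤ remezConst ν N := by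
  have := hν.growthExponent_nonneg (2 * (N - 1))
  unfold remezConst growthConst
  gcongr
  linarith

/-! ### The sup-norm Remez inequality on a convex body -/

section AdmissibleData

variable {d N : ℕ} {μ : ℕ → ℝ} {K : ConvexBody (EuclideanSpace ℝ (Fin d))}

theorem IsAdmissibleData.one_le (h : IsAdmissibleData μ K N) : 1 ≤ N := by
  have := h.assoc
  have h1 : (1 : ℕ∞) ≤ N := by rw [this]; exact le_add_self
  exact_mod_cast h1

theorem IsAdmissibleData.diam_pos (hd : 1 ≤ d) (h : IsAdmissibleData μ K N) :
    0 < Metric.diam (K : Set (EuclideanSpace ℝ (Fin d))) := by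
  have : Nonempty (Fin d) := ⟨⟨0, hd⟩⟩
  by_contra! hcon
  obtain ⟨x, hx⟩ := h.interior_nonempty
  have hsub : (K : Set (EuclideanSpace ℝ (Fin d))).Subsingleton := fun a ha b hb =>
    dist_le_zero.1 ((Metric.dist_le_diam_of_mem K.isCompact.isBounded ha hb).trans hcon)
  have hK : (K : Set (EuclideanSpace ℝ (Fin d))) = {x} :=
    hsub.eq_singleton_of_mem (interior_subset hx)
  rw [hK, interior_singleton] at hx
  exact hx

/-- N is one more than the degree of δ_K μ, so the sum up to N cannot stay below e; otherwise N + 1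
≤ N. As j_0(1) = 0, the sum starts at 1. -/
theorem IsAdmissibleData.exp_mul_diam_le (hd : 1 ≤ d) (h : IsAdmissibleData μ K N) :
    Real.exp 1 * Metric.diam (K : Set (EuclideanSpace ℝ (Fin d))) ≤ weightSum μ 1 N := by
  set δ := Metric.diam (K : Set (EuclideanSpace ℝ (Fin d)))
  have hδ : 0 < δ := h.diam_pos hd
  by_contra! hcon
  have h1 : weightSum (fun j => δ * μ j) (startIndex 1 + 1) N < Real.exp 1 := by
    have : weightSum (fun j => δ * μ j) (startIndex 1 + 1) N = weightSum μ 1 N / δ := by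
      simp only [weightSum, startIndex, inv_one, Real.log_one, Nat.ceil_zero, zero_add,
        Finset.sum_div]
      exact Finset.sum_congr rfl fun j _ => by rw [mul_comm, div_div]
    rw [this, div_lt_iff₀ hδ]
    exact hcon
  have h2 : (N : ℕ∞) ≤ weightDegree (fun j => δ * μ j) 1 := le_sSup ⟨N, rfl, h1⟩
  have h3 := h.assoc
  have h4 : (N : ℕ∞) + 1 ≤ N := by
    conv_rhs => rw [h3]
    gcongr
  have h5 : N + 1 ≤ N := by exact_mod_cast h4
  omega

theorem IsAdmissibleData.volume_pos (h : IsAdmissibleData μ K N) :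
    0 < volume (K : Set (EuclideanSpace ℝ (Fin d))) :=
  (isOpen_interior.measure_pos volume h.interior_nonempty).trans_le (measure_mono interior_subset)

/-- The Remez inequality for the sup-norm. -/
theorem supNorm_le_of_abs_le (hd : 1 ≤ d) {ν : ℝ → ℝ} (hν : IsInterpolant ν μ)
    (hdata : IsAdmissibleData μ K N) {f : EuclideanSpace ℝ (Fin d) → ℝ}
    (hf : IsWeightSmooth μ (2 * (N - 1)) (supNorm (K : Set (EuclideanSpace ℝ (Fin d))) f)
      (K : Set (EuclideanSpace ℝ (Fin d))) f) (hN : N ≠ 1)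
    {E : Set (EuclideanSpace ℝ (Fin d))} (hE : NullMeasurableSet E volume)
    (hEK : E ⊆ (K : Set (EuclideanSpace ℝ (Fin d)))) (hEpos : 0 < volume E) {t : ℝ}
    (ht : ∀ x ∈ E, |f x| ≤ t) :
    supNorm (K : Set (EuclideanSpace ℝ (Fin d))) f ≤
      (remezConst ν N * d * volume.real (K : Set (EuclideanSpace ℝ (Fin d))) / volume.real E) ^
        (2 * (N - 1)) * t := by
  have hN1 := hdata.one_le
  obtain ⟨U, hU, hKU, hfU⟩ := hf.contDiff
  have hfK : ContinuousOn f (K : Set (EuclideanSpace ℝ (Fin d))) := hfU.continuousOn.mono hKU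
  have hd0 : (0 : ℝ) < d := by exact_mod_cast hd
  obtain ⟨F, hFE, hF, hFae⟩ := hE.exists_measurable_subset_ae_eq
  have hFvol : volume F = volume E := measure_congr hFae
  have hFr : volume.real F = volume.real E := by simp only [measureReal_def, hFvol]
  have hEr : 0 < volume.real E := ENNReal.toReal_pos hEpos.ne'
    ((measure_mono hEK).trans_lt K.isCompact.measure_lt_top).ne
  have hKr : 0 < volume.real (K : Set (EuclideanSpace ℝ (Fin d))) :=
    hEr.trans_le (measureReal_mono hEK K.isCompact.measure_ne_top)
  obtain ⟨x₀, hx₀, hmax⟩ := K.isCompact.exists_isMaxOn K.nonempty hfK.abs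
  have hsup : |f x₀| = supNorm (K : Set (EuclideanSpace ℝ (Fin d))) f := by
    have : Nonempty (K : Set (EuclideanSpace ℝ (Fin d))) := ⟨⟨x₀, hx₀⟩⟩
    exact le_antisymm (abs_le_supNorm K.isCompact hfK hx₀) (ciSup_le fun y => hmax y.2)
  obtain ⟨θ, hθ, L, hL, hseg, T, hTL, hTF, hTvol⟩ := exists_segment_of_volume_pos hd K.isCompact
    K.convex hx₀ hF (hFE.trans hEK) (by rwa [hFvol])
  rw [hFr] at hTvol
  have hLδ : L ≤ Metric.diam (K : Set (EuclideanSpace ℝ (Fin d))) := by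
    have := Metric.dist_le_diam_of_mem K.isCompact.isBounded (hseg L ⟨hL.le, le_rfl⟩) hx₀
    rwa [dist_eq_norm, add_sub_cancel_left, norm_smul, hθ, mul_one, Real.norm_of_nonneg hL.le]
      at this
  have hmain := remez_interval hdata.weight (n₀ := N - 1) (by omega) hL
    ((mul_le_mul_of_nonneg_left hLδ (Real.exp_pos 1).le).trans (by
      rw [Nat.sub_add_cancel hN1]
      exact hdata.exp_mul_diam_le hd)) hf.pos
    (G := fun l t => directionDeriv f θ l (x₀ + t • θ))
    (fun l hl x hx => hasDerivAt_directionDeriv hU hfU hl (hKU (hseg x hx)))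
    (fun l hl x hx => (abs_directionDeriv_le K.isCompact hU hKU hfU hl (hseg x hx) hθ).trans
      (hf.bound l hl))
    (by simpa [directionDeriv_zero] using hsup) hTL (by positivity) hTvol
    (ε := t) (fun x hx => by
      simpa [directionDeriv_zero] using ht _ (hFE (hTF x hx)))
  have ht0 : 0 ≤ t := by
    obtain ⟨x, hx⟩ := nonempty_of_measure_ne_zero hEpos.ne'
    exact (abs_nonneg _).trans (ht x hx)
  refine hmain.trans (mul_le_mul_of_nonneg_right (pow_le_pow_left₀ (by positivity) ?_ _) ht0)
  set k := volume.real (K : Set (EuclideanSpace ℝ (Fin d)))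
  set m := volume.real E
  -- L cancels. The 2 of `remez_interval` and the 2 of the segment lemma combine to the 4 in C_N.
  calc 2 * Real.exp 4 * (L / (L * m / (2 * d * k))) = 4 * Real.exp 4 * d * k / m := by
        field_simp
        ring
    _ ≤ _ := by
        gcongr
        exact hν.le_remezConst N

end AdmissibleData

/-! ### From sublevel sets to integrals; interpolation of norms -/

/-- A lower bound for an integral from a power-type bound for the distribution function. -/
theorem ofReal_le_lintegral_of_distribution {α : Type*} [MeasurableSpace α] {m : Measure α}
    [IsFiniteMeasure m] {G : α → ℝ} (hG : ∀ x, 0 ≤ G x) (hGm : AEMeasurable G m) {Q W κ : ℝ}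
    (hQ : 0 < Q) (hW : 0 < W) (hκ : 0 < κ) (hV : 0 < m.real univ)
    (h : ∀ s > 0, 0 < m.real {x | G x ≤ s} → Q ≤ (W / m.real {x | G x ≤ s}) ^ κ * s) :
    ENNReal.ofReal (Q * (m.real univ / W) ^ κ / (κ + 1) * m.real univ) ≤
      ∫⁻ x, ENNReal.ofReal (G x) ∂m := by
  set V := m.real univ with hVdef
  -- T is the level at which the bound V (s/T)^{1/κ} for the measure of {G ≤ s} reaches the total
  -- mass V; beyond it the hypothesis says nothing.
  set T := Q * (V / W) ^ κ with hT
  have hT0 : 0 < T := by positivity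
  have hpt : ∀ s ∈ Ioc 0 T, ENNReal.ofReal (V * (1 - (s / T) ^ κ⁻¹)) ≤ m {x | s < G x} := by
    intro s hs
    have hs0 : 0 < s := hs.1
    set a := m.real {x | G x ≤ s} with ha
    have ha0 : 0 ≤ a := measureReal_nonneg
    have hbound : a ≤ V * (s / T) ^ κ⁻¹ := by
      rcases ha0.eq_or_lt with h0 | h0
      · rw [← h0]; positivity
      · have h1 := h s hs0 h0
        have h2 : (a / V) ^ κ ≤ s / T := by
          rw [le_div_iff₀ hT0, hT]
          calc (a / V) ^ κ * (Q * (V / W) ^ κ) ≤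
                (a / V) ^ κ * (((W / a) ^ κ * s) * (V / W) ^ κ) := by gcongr
            _ = ((a / V) * (W / a) * (V / W)) ^ κ * s := by
                rw [Real.mul_rpow (by positivity) (by positivity),
                  Real.mul_rpow (by positivity) (by positivity)]
                ring
            _ = s := by
                rw [show (a / V) * (W / a) * (V / W) = 1 by field_simp, Real.one_rpow, one_mul]
        have h3 := (Real.le_rpow_inv_iff_of_pos (by positivity) (by positivity) hκ).2 h2
        rwa [div_le_iff₀ hV, mul_comm] at h3
    have hset : {x | s < G x} = {x | G x ≤ s}ᶜ := by ext x; simp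
    have hnull : NullMeasurableSet {x | G x ≤ s} m := nullMeasurableSet_le hGm aemeasurable_const
    rw [hset, ← ENNReal.ofReal_toReal (measure_ne_top m {x | G x ≤ s}ᶜ)]
    refine ENNReal.ofReal_le_ofReal ?_
    have hcompl : m.real {x | G x ≤ s}ᶜ = V - a := by
      have := measureReal_add_measureReal_compl₀ hnull
      linarith
    change _ ≤ m.real {x | G x ≤ s}ᶜ
    rw [hcompl]
    linarith
  -- ∫_0^1 (1 − u^{1/κ}) du = 1/(κ+1); with κ = 2q(N−1) this becomes the factor (2q(N−1)+1)^{1/q}.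
  have hint : ∫ s in (0 : ℝ)..T, V * (1 - (s / T) ^ κ⁻¹) = T / (κ + 1) * V := by
    have hκ' : (0 : ℝ) < κ⁻¹ := inv_pos.2 hκ
    have hi : IntervalIntegrable (fun s : ℝ => (s / T) ^ κ⁻¹) volume 0 T :=
      ((continuous_id.div_const T).rpow_const fun _ => Or.inr hκ'.le).intervalIntegrable _ _
    rw [intervalIntegral.integral_const_mul, intervalIntegral.integral_sub
      (intervalIntegrable_const) hi, intervalIntegral.integral_comp_div (fun u : ℝ => u ^ κ⁻¹)
      hT0.ne', zero_div, div_self hT0.ne', integral_rpow (Or.inl (by linarith))]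
    rw [Real.one_rpow, Real.zero_rpow (by positivity)]
    simp
    field_simp
    ring
  rw [lintegral_eq_lintegral_meas_lt m (ae_of_all _ hG) hGm, ← hint,
    intervalIntegral.integral_of_le hT0.le]
  rw [ofReal_integral_eq_lintegral_ofReal]
  · calc _ ≤ ∫⁻ s in Ioc 0 T, m {x | s < G x} := setLIntegral_mono' measurableSet_Ioc hpt
      _ ≤ _ := lintegral_mono_set Ioc_subset_Ioi_self
  · refine Continuous.integrableOn_Ioc ?_
    exact continuous_const.mul (continuous_const.sub
      ((continuous_id.div_const T).rpow_const fun _ => Or.inr (by positivity)))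
  · filter_upwards [ae_restrict_mem measurableSet_Ioc] with s hs
    have : (s / T) ^ κ⁻¹ ≤ 1 := Real.rpow_le_one (div_nonneg hs.1.le hT0.le)
      ((div_le_one hT0).2 hs.2) (by positivity)
    exact mul_nonneg hV.le (by linarith)

/-- Interpolation of `L^p`-norms between `L^q` and `L^∞`. -/
theorem eLpNorm_le_rpow_mul_rpow {α : Type*} [MeasurableSpace α] {m : Measure α} {f : α → ℝ}
    {S : ℝ} (hf : ∀ᵐ x ∂m, |f x| ≤ S) {p q : ℝ≥0∞} (hq : 0 < q) (hqp : q < p) :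
    eLpNorm f p m ≤
      ENNReal.ofReal S ^ (1 - (q / p).toReal) * eLpNorm f q m ^ (q / p).toReal := by
  have hqtop : q ≠ ∞ := hqp.ne_top
  rcases eq_or_ne p ∞ with rfl | hp
  · simp only [ENNReal.div_top, ENNReal.toReal_zero, sub_zero, ENNReal.rpow_one, ENNReal.rpow_zero,
      mul_one]
    rw [eLpNorm_exponent_top]
    exact eLpNormEssSup_le_of_ae_bound hf
  · have hp0 : p ≠ 0 := (hq.trans hqp).ne'
    have hqr : 0 < q.toReal := ENNReal.toReal_pos hq.ne' hqtop
    have hpr : 0 < p.toReal := ENNReal.toReal_pos hp0 hp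
    have hqpr : q.toReal < p.toReal := (ENNReal.toReal_lt_toReal hqtop hp).2 hqp
    rw [eLpNorm_eq_lintegral_rpow_enorm_toReal hp0 hp,
      eLpNorm_eq_lintegral_rpow_enorm_toReal hq.ne' hqtop, ENNReal.toReal_div]
    set P := p.toReal
    set R := q.toReal
    have h1 : ∫⁻ x, ‖f x‖ₑ ^ P ∂m ≤ ENNReal.ofReal S ^ (P - R) * ∫⁻ x, ‖f x‖ₑ ^ R ∂m := by
      rw [← lintegral_const_mul' _ _
        (ENNReal.rpow_ne_top_of_nonneg (by linarith) ENNReal.ofReal_ne_top)]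
      refine lintegral_mono_ae ?_
      filter_upwards [hf] with x hx
      have h2 : ‖f x‖ₑ ≤ ENNReal.ofReal S := by
        rw [Real.enorm_eq_ofReal_abs]
        exact ENNReal.ofReal_le_ofReal hx
      calc ‖f x‖ₑ ^ P = ‖f x‖ₑ ^ (P - R) * ‖f x‖ₑ ^ R := by
            rw [← ENNReal.rpow_add_of_nonneg _ _ (by linarith) hqr.le]; ring_nf
        _ ≤ _ := by gcongr
    calc (∫⁻ x, ‖f x‖ₑ ^ P ∂m) ^ (1 / P)
        ≤ (ENNReal.ofReal S ^ (P - R) * ∫⁻ x, ‖f x‖ₑ ^ R ∂m) ^ (1 / P) := by gcongr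
      _ = _ := by
        rw [ENNReal.mul_rpow_of_nonneg _ _ (by positivity), ← ENNReal.rpow_mul, ← ENNReal.rpow_mul]
        congr 2 <;> field_simp

/-! ### Normalized norms -/

section NormalizedNorms

variable {d N : ℕ} {μ : ℕ → ℝ} {ν : ℝ → ℝ} {K : ConvexBody (EuclideanSpace ℝ (Fin d))}
  {f : EuclideanSpace ℝ (Fin d) → ℝ}

theorem IsWeightSmooth.continuousOn {n : ℕ} {M : ℝ} {S : Set (EuclideanSpace ℝ (Fin d))}
    (hf : IsWeightSmooth μ n M S f) : ContinuousOn f S := by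
  obtain ⟨U, -, hSU, hfU⟩ := hf.contDiff
  exact hfU.continuousOn.mono hSU

/-- The sup-norm on `K` is controlled by the normalized `L^q`-norm on a subset of positive
measure. -/
theorem supNorm_le_normalizedLp (hd : 1 ≤ d) (hν : IsInterpolant ν μ)
    (hdata : IsAdmissibleData μ K N)
    (hf : IsWeightSmooth μ (2 * (N - 1)) (supNorm (K : Set (EuclideanSpace ℝ (Fin d))) f)
      (K : Set (EuclideanSpace ℝ (Fin d))) f) (hN : N ≠ 1)
    {E : Set (EuclideanSpace ℝ (Fin d))} (hE : NullMeasurableSet E volume)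
    (hEK : E ⊆ (K : Set (EuclideanSpace ℝ (Fin d)))) (hEpos : 0 < volume E)
    {q : ℝ≥0∞} (hq : 0 < q) (hqtop : q ≠ ∞) :
    ENNReal.ofReal (supNorm (K : Set (EuclideanSpace ℝ (Fin d))) f) ≤
      ENNReal.ofReal
          ((remezConst ν N * d * volume.real (K : Set (EuclideanSpace ℝ (Fin d)))
              / volume.real E) ^ (2 * ((N : ℝ) - 1)))
        * ENNReal.ofReal ((2 * q.toReal * ((N : ℝ) - 1) + 1) ^ (1 / q).toReal)
        * normalizedLp f q E := by
  have hN1 := hdata.one_le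
  obtain ⟨n, rfl⟩ : ∃ n, N = n + 1 := ⟨N - 1, by omega⟩
  have hn : 1 ≤ n := by omega
  have hn0 : (0 : ℝ) < n := by exact_mod_cast hn
  have hd0 : (0 : ℝ) < d := by exact_mod_cast hd
  have hEtop : volume E ≠ ∞ := ((measure_mono hEK).trans_lt K.isCompact.measure_lt_top).ne
  have hV : 0 < volume.real E := ENNReal.toReal_pos hEpos.ne' hEtop
  have hKr : 0 < volume.real (K : Set (EuclideanSpace ℝ (Fin d))) :=
    hV.trans_le (measureReal_mono hEK K.isCompact.measure_ne_top)
  have hC : 0 < remezConst ν (n + 1) := (by positivity : 0 < 4 * Real.exp 4).trans_le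
    (hν.le_remezConst _)
  have hS := hf.pos
  have hR : 0 < q.toReal := ENNReal.toReal_pos hq.ne' hqtop
  have hfin : IsFiniteMeasure (volume.restrict E) := ⟨by
    rw [Measure.restrict_apply_univ]; exact hEtop.lt_top⟩
  have hfm : AEMeasurable f (volume.restrict E) :=
    (hf.continuousOn.aemeasurable K.isCompact.measurableSet).mono_measure
      (Measure.restrict_mono hEK le_rfl)
  have hsup : ∀ {E' : Set (EuclideanSpace ℝ (Fin d))} (_ : NullMeasurableSet E' volume)
      (_ : E' ⊆ (K : Set (EuclideanSpace ℝ (Fin d)))) (_ : 0 < volume E') {t : ℝ}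
      (_ : ∀ x ∈ E', |f x| ≤ t), _ := fun h1 h2 h3 _ h4 =>
    supNorm_le_of_abs_le hd hν hdata hf hN h1 h2 h3 h4
  rw [Nat.add_sub_cancel] at hsup
  set S := supNorm (K : Set (EuclideanSpace ℝ (Fin d))) f
  set W := remezConst ν (n + 1) * d * volume.real (K : Set (EuclideanSpace ℝ (Fin d)))
  have hW : 0 < W := by positivity
  set R := q.toReal
  set V := volume.real E with hVdef
  set κ := 2 * R * n with hκ
  have hκ0 : 0 < κ := by positivity
  have hmV : (volume.restrict E).real univ = V := by simp [measureReal_def, hVdef]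
  have hGm : AEMeasurable (fun x => |f x| ^ R) (volume.restrict E) := by fun_prop
  -- Each set {|f|^q ≤ s} ∩ E of positive measure takes the role of E in the sup-norm inequality,
  -- with t = s^{1/q}. Raising to the power q turns the exponent 2n into κ = 2qn.
  have hmain := ofReal_le_lintegral_of_distribution (m := volume.restrict E)
    (G := fun x => |f x| ^ R) (fun x => by positivity) hGm (Q := S ^ R) (W := W) (κ := κ)
    (by positivity) hW hκ0 (by rwa [hmV]) (by
      intro s hs ha
      set A := {x | |f x| ^ R ≤ s}
      have hA : NullMeasurableSet (A ∩ E) volume :=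
        (nullMeasurableSet_restrict hE).1 (nullMeasurableSet_le hGm aemeasurable_const)
      have hAE : (volume.restrict E) A = volume (A ∩ E) := Measure.restrict_apply₀' hE
      have hAEr : (volume.restrict E).real A = volume.real (A ∩ E) := by
        simp only [measureReal_def, hAE]
      rw [hAEr] at ha ⊢
      have h1 := hsup hA (inter_subset_right.trans hEK)
        ((ENNReal.toReal_pos_iff.1 ha).1) (t := s ^ R⁻¹)
        fun x hx => (Real.le_rpow_inv_iff_of_pos (abs_nonneg _) hs.le hR).2 hx.1
      calc S ^ R ≤ ((W / volume.real (A ∩ E)) ^ (2 * n) * s ^ R⁻¹) ^ R := by gcongr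
        _ = _ := by
          rw [Real.mul_rpow (by positivity) (by positivity), ← Real.rpow_mul hs.le,
            inv_mul_cancel₀ hR.ne', Real.rpow_one, ← Real.rpow_natCast,
            ← Real.rpow_mul (by positivity), hκ]
          push_cast
          ring_nf)
  rw [hmV] at hmain
  set X := S ^ R * (V / W) ^ κ / (κ + 1) with hX
  have hX0 : 0 ≤ X := by positivity
  have hlow : ENNReal.ofReal (X ^ (1 / R)) ≤ normalizedLp f q E := by
    rw [normalizedLp, eLpNorm_eq_lintegral_rpow_enorm_toReal hq.ne' hqtop, lintegral_smul_measure,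
      ← ENNReal.ofReal_rpow_of_nonneg hX0 (by positivity)]
    gcongr
    have h1 : ∀ x, ‖f x‖ₑ ^ q.toReal = ENNReal.ofReal (|f x| ^ R) := fun x => by
      rw [Real.enorm_eq_ofReal_abs, ENNReal.ofReal_rpow_of_nonneg (abs_nonneg _) hR.le]
    simp only [h1]
    calc ENNReal.ofReal X = (volume E)⁻¹ * ENNReal.ofReal (X * V) := by
          rw [ENNReal.ofReal_mul hX0, hVdef, ofReal_measureReal hEtop, mul_comm (ENNReal.ofReal X),
            ← mul_assoc, ENNReal.inv_mul_cancel hEpos.ne' hEtop, one_mul]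
      _ ≤ _ := by
          rw [smul_eq_mul]
          gcongr
  have hqinv : (1 / q).toReal = 1 / R := by simp [R]
  have hNn : ((n + 1 : ℕ) : ℝ) - 1 = n := by push_cast; ring
  rw [hqinv, hNn]
  have hXR : X ^ (1 / R) = S * (V / W) ^ (2 * (n : ℝ)) / (κ + 1) ^ (1 / R) := by
    rw [hX, Real.div_rpow (by positivity) (by positivity), Real.mul_rpow (by positivity)
      (by positivity), ← Real.rpow_mul hS.le, ← Real.rpow_mul (by positivity),
      mul_one_div_cancel hR.ne', Real.rpow_one, show κ * (1 / R) = 2 * (n : ℝ) by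
        rw [hκ]; field_simp]
  refine le_trans (le_of_eq ?_) (mul_le_mul_right hlow _)
  rw [← ENNReal.ofReal_mul (by positivity), ← ENNReal.ofReal_mul (by positivity), hXR]
  congr 1
  have h1 : (W / V) ^ (2 * (n : ℝ)) * (V / W) ^ (2 * (n : ℝ)) = 1 := by
    rw [← Real.mul_rpow (by positivity) (by positivity), show W / V * (V / W) = 1 by field_simp,
      Real.one_rpow]
  have h2 : 0 < (κ + 1) ^ (1 / R) := by positivity
  calc S = ((W / V) ^ (2 * (n : ℝ)) * (V / W) ^ (2 * (n : ℝ))) * S := by rw [h1, one_mul]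
    _ = (W / V) ^ (2 * (n : ℝ)) * (κ + 1) ^ (1 / R) *
        (S * (V / W) ^ (2 * (n : ℝ)) / (κ + 1) ^ (1 / R)) := by field_simp

theorem ae_abs_le_supNorm (hf : ContinuousOn f (K : Set (EuclideanSpace ℝ (Fin d)))) :
    ∀ᵐ x ∂((volume (K : Set (EuclideanSpace ℝ (Fin d))))⁻¹ •
      volume.restrict (K : Set (EuclideanSpace ℝ (Fin d)))),
      |f x| ≤ supNorm (K : Set (EuclideanSpace ℝ (Fin d))) f := by
  refine Measure.ae_smul_measure ?_ _
  filter_upwards [ae_restrict_mem K.isCompact.measurableSet] with x hx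
  exact abs_le_supNorm K.isCompact hf hx

theorem normalizedLp_le_supNorm (hf : ContinuousOn f (K : Set (EuclideanSpace ℝ (Fin d))))
    (hK : 0 < volume (K : Set (EuclideanSpace ℝ (Fin d)))) (p : ℝ≥0∞) :
    normalizedLp f p K ≤ ENNReal.ofReal (supNorm (K : Set (EuclideanSpace ℝ (Fin d))) f) := by
  refine (eLpNorm_le_of_ae_bound (ae_abs_le_supNorm hf)).trans (le_of_eq ?_)
  rw [Measure.smul_apply, Measure.restrict_apply_univ, smul_eq_mul,
    ENNReal.inv_mul_cancel hK.ne' K.isCompact.measure_ne_top, ENNReal.one_rpow, one_mul]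

/-- The bound for the sup-norm enters to the power 1 − q/p, and (1/q)(1 − q/p) = 1/q − 1/p. -/
theorem normalizedLp_le_interpolation (hd : 1 ≤ d) (hν : IsInterpolant ν μ)
    (hdata : IsAdmissibleData μ K N)
    (hf : IsWeightSmooth μ (2 * (N - 1)) (supNorm (K : Set (EuclideanSpace ℝ (Fin d))) f)
      (K : Set (EuclideanSpace ℝ (Fin d))) f) (hN : N ≠ 1)
    {E : Set (EuclideanSpace ℝ (Fin d))} (hE : NullMeasurableSet E volume)
    (hEK : E ⊆ (K : Set (EuclideanSpace ℝ (Fin d)))) (hEpos : 0 < volume E)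
    {p q : ℝ≥0∞} (hq : 0 < q) (hqp : q < p) :
    normalizedLp f p K ≤
      ENNReal.ofReal
          ((remezConst ν N * d * volume.real (K : Set (EuclideanSpace ℝ (Fin d)))
              / volume.real E) ^ (2 * ((N : ℝ) - 1) * (1 - (q / p).toReal)))
        * ENNReal.ofReal
          ((2 * q.toReal * ((N : ℝ) - 1) + 1) ^ ((1 / q).toReal - (1 / p).toReal))
        * normalizedLp f q K ^ (q / p).toReal
        * normalizedLp f q E ^ (1 - (q / p).toReal) := by
  have hqtop : q ≠ ∞ := hqp.ne_top
  have hR : 0 < q.toReal := ENNReal.toReal_pos hq.ne' hqtop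
  have hθ : (q / p).toReal ≤ 1 := by
    refine ENNReal.toReal_le_of_le_ofReal zero_le_one ?_
    rw [ENNReal.ofReal_one]
    exact ENNReal.div_le_of_le_mul (by rw [one_mul]; exact hqp.le)
  have hinv : (1 / q).toReal - (1 / p).toReal = (1 / q).toReal * (1 - (q / p).toReal) := by
    rcases eq_or_ne p ∞ with rfl | hp
    · simp
    · simp only [ENNReal.toReal_div, ENNReal.toReal_one]
      field_simp
  have hN1 : (0 : ℝ) ≤ (N : ℝ) - 1 := sub_nonneg.2 (by exact_mod_cast hdata.one_le)
  have hC : 0 < remezConst ν N := (by positivity : 0 < 4 * Real.exp 4).trans_le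
    (hν.le_remezConst _)
  have h1 : normalizedLp f p K ≤ _ :=
    eLpNorm_le_rpow_mul_rpow (ae_abs_le_supNorm hf.continuousOn) hq hqp
  have h2 := supNorm_le_normalizedLp hd hν hdata hf hN hE hEK hEpos hq hqtop
  refine h1.trans ((mul_le_mul_left (ENNReal.rpow_le_rpow h2 (sub_nonneg.2 hθ)) _).trans
    (le_of_eq ?_))
  rw [ENNReal.mul_rpow_of_nonneg _ _ (sub_nonneg.2 hθ),
    ENNReal.mul_rpow_of_nonneg _ _ (sub_nonneg.2 hθ),
    ENNReal.ofReal_rpow_of_nonneg (by positivity) (sub_nonneg.2 hθ),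
    ENNReal.ofReal_rpow_of_nonneg (by positivity) (sub_nonneg.2 hθ),
    ← Real.rpow_mul (by positivity), ← Real.rpow_mul (by positivity), hinv]
  change _ * normalizedLp f q K ^ (q / p).toReal = _
  ring

end NormalizedNorms



/-! ### The three inequalities -/

theorem mainTheorem8 {d : ℕ} (hd : 1 ≤ d) (μ : ℕ → ℝ) (ν : ℝ → ℝ) (hν : IsInterpolant ν μ)
    (K : ConvexBody (EuclideanSpace ℝ (Fin d))) (N : ℕ) (hdata : IsAdmissibleData μ K N)
    (f : EuclideanSpace ℝ (Fin d) → ℝ)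
    (hf : IsWeightSmooth μ (2 * (N - 1)) (supNorm (K : Set (EuclideanSpace ℝ (Fin d))) f)
      (K : Set (EuclideanSpace ℝ (Fin d))) f) :
    (∀ E : Set (EuclideanSpace ℝ (Fin d)), NullMeasurableSet E volume →
      E ⊆ (K : Set (EuclideanSpace ℝ (Fin d))) → 0 < volume E →
      ∀ p q : ℝ≥0∞, 0 < q → q < p →
        normalizedLp f p K ≤ boundOrTop N
          (ENNReal.ofReal
              ((remezConst ν N * d * volume.real (K : Set (EuclideanSpace ℝ (Fin d)))
                  / volume.real E) ^ (2 * ((N : ℝ) - 1) * (1 - (q / p).toReal)))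
            * ENNReal.ofReal
              ((2 * q.toReal * ((N : ℝ) - 1) + 1) ^ ((1 / q).toReal - (1 / p).toReal))
            * normalizedLp f q K ^ (q / p).toReal
            * normalizedLp f q E ^ (1 - (q / p).toReal)))
    ∧ (∀ p q : ℝ≥0∞, 0 < q → q < p →
        normalizedLp f p K ≤ boundOrTop N
          (ENNReal.ofReal
              ((remezConst ν N * d) ^ (2 * ((N : ℝ) - 1) * (1 - (q / p).toReal)))
            * ENNReal.ofReal
              ((2 * q.toReal * ((N : ℝ) - 1) + 1) ^ ((1 / q).toReal - (1 / p).toReal))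
            * normalizedLp f q K))
    ∧ (∀ E : Set (EuclideanSpace ℝ (Fin d)), NullMeasurableSet E volume →
      E ⊆ (K : Set (EuclideanSpace ℝ (Fin d))) → 0 < volume E →
      ∀ p q : ℝ≥0∞, 0 < q → q < p →
        normalizedLp f p K ≤ boundOrTop N
          (ENNReal.ofReal
              ((remezConst ν N * d * volume.real (K : Set (EuclideanSpace ℝ (Fin d)))
                  / volume.real E) ^ (2 * ((N : ℝ) - 1)))
            * ENNReal.ofReal ((2 * q.toReal * ((N : ℝ) - 1) + 1) ^ (1 / q).toReal)
            * normalizedLp f q E)) := by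
  have hKpos := hdata.volume_pos
  have hKnull : NullMeasurableSet (K : Set (EuclideanSpace ℝ (Fin d))) volume :=
    K.isCompact.measurableSet.nullMeasurableSet
  have hKr : volume.real (K : Set (EuclideanSpace ℝ (Fin d))) ≠ 0 :=
    (ENNReal.toReal_pos hKpos.ne' K.isCompact.measure_ne_top).ne'
  refine ⟨fun E hE hEK hEpos p q hq hqp => ?_, fun p q hq hqp => ?_,
    fun E hE hEK hEpos p q hq hqp => ?_⟩
  -- For N = 1 the bound is ⊤; otherwise N − 1 ≥ 1, as the one-variable inequality requires.
  all_goals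
    unfold boundOrTop
    split_ifs with hN
    · exact le_top
  · exact normalizedLp_le_interpolation hd hν hdata hf hN hE hEK hEpos hq hqp
  -- Take E = K: the volume ratio cancels and the two powers of the L^q-norm have exponents adding
  -- up to 1.
  · refine (normalizedLp_le_interpolation hd hν hdata hf hN hKnull Subset.rfl hKpos hq
      hqp).trans (le_of_eq ?_)
    have hθ : (q / p).toReal ≤ 1 := by
      refine ENNReal.toReal_le_of_le_ofReal zero_le_one ?_
      rw [ENNReal.ofReal_one]
      exact ENNReal.div_le_of_le_mul (by rw [one_mul]; exact hqp.le)
    rw [mul_div_cancel_right₀ _ hKr, mul_assoc _ (normalizedLp f q K ^ _),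
      ← ENNReal.rpow_add_of_nonneg _ _ ENNReal.toReal_nonneg (sub_nonneg.2 hθ),
      add_sub_cancel, ENNReal.rpow_one]
  · exact (normalizedLp_le_supNorm hf.continuousOn hKpos p).trans
      (supNorm_le_normalizedLp hd hν hdata hf hN hE hEK hEpos hq hqp.ne_top)
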